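/- Let $0<q<1$ and let $\mathcal A=\mathcal A(SU_q(2))$ be the unital $*$-algebra generated by $a,c$ with $uu^*=u^*u=1$ for $u=\begin{pmatrix}a&-qc^*\\ c&a^*\end{pmatrix}$, with Haar state $h$. Let $\mathcal L_n$ ($n\in\mathbb Z$) be the charge components of the right $U(1)$-coaction, so that $a,c\in\mathcal L_{-1}$ and $a^*,c^*\in\mathcal L_1$. Let $\Gamma$ be the bimodule of 1-forms of Woronowicz's left covariant 3d calculus: the free left $\mathcal A$-module on $\omega_-,\omega_+,\omega_z$ (with span $\Gamma_{\rm inv}$ over $\mathbb C$), with $\omega_zx=q^{2n}x\omega_z$, $\omega_\pm x=q^nx\omega_\pm$ for $x\in\mathcal L_n$, $\omega_-^*=-\omega_+$, $\omega_z^*=-\omega_z$, $(x\omega)^*=\omega^*x^*$. Let $\sigma$ be the left $\mathcal A$-linear braiding on $\Gamma^{\otimes2}$ with $$\begin{aligned}&\sigma(\omega_a\otimes\omega_a)=\omega_a\otimes\omega_a,\\ &\sigma(\omega_-\otimes\omega_+)=(1-q^2)\,\omega_-\otimes\omega_++q^{-2}\omega_+\otimes\omega_-,\quad \sigma(\omega_+\otimes\omega_-)=q^4\omega_-\otimes\omega_+,\\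 &\sigma(\omega_-\otimes\omega_z)=(1-q^2)\,\omega_-\otimes\omega_z+q^{-4}\omega_z\otimes\omega_-,\quad \sigma(\omega_z\otimes\omega_-)=q^6\omega_-\otimes\omega_z,\\ &\sigma(\omega_z\otimes\omega_+)=(1-q^2)\,\omega_z\otimes\omega_++q^{-4}\omega_+\otimes\omega_z,\quad \sigma(\omega_+\otimes\omega_z)=q^6\omega_z\otimes\omega_+.\end{aligned}$$ Put $A^{(0)}=A^{(1)}=1$, $A^{(2)}=1-\sigma$, $A^{(3)}=(1-\sigma_2)(1-\sigma_1+\sigma_1\sigma_2)$, where $\sigma_1=\sigma\otimes1$ and $\sigma_2=1\otimes\sigma$; let $\Gamma^{\wedge k}={\rm Range}\,A^{(k)}$ for $0\le k\le 3$, with wedge product $A^{(k)}s\wedge A^{(l)}t=A^{(k+l)}(s\otimes t)$ and the graded involution $(\phi\wedge\psi)^*=(-1)^{kl}\psi^*\wedge\phi^*$. The operator $A^{(k)}$ acts on $\Gamma^{\wedge k}$ as the scalar $\lambda_k$, where $\lambda_0=\lambda_1=1$, $\lambda_2=1+q^2$, $\lambda_3=1+2q^2+2q^4+q^6$. Let $\theta=\omega_-\wedge\omega_+\wedge\omega_z$;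 for a real $m\ne0$ let $\mu=m\theta$ and $\int_\mu x\mu=h(x)$. A contraction is a $\mathbb C$-bilinear map $g:\Gamma_{\rm inv}\times\Gamma_{\rm inv}\to\mathbb C$; it is extended to $\Gamma_{\rm inv}^{\otimes k}$ factor by factor, $g(\omega_{a_1}\otimes\cdots\otimes\omega_{a_k},\omega_{b_1}\otimes\cdots\otimes\omega_{b_k})=\prod_jg(\omega_{a_j},\omega_{b_j})$, and restricted to $\Gamma_{\rm inv}^{\wedge k}=A^{(k)}(\Gamma_{\rm inv}^{\otimes k})$. It is right $U(1)$-invariant if it is invariant under the coaction $\omega_a\mapsto\omega_a\otimes z^{n_a}$, $n_\pm=\pm2$, $n_z=0$. 1. The non-degenerate right $U(1)$-invariant contractions are exactly those with $g(\omega_-,\omega_+)=\alpha$, $g(\omega_+,\omega_-)=\beta$, $g(\omega_z,\omega_z)=\gamma$, all other coefficients zero, where $\alpha,\beta,\gamma\in\mathbb C$ and $\alpha\beta\gamma\neq0$. 2. For each such $g$ and each real $m\neq0$ there is exactly one family of $\mathbb C$-linear maps $T:\Gamma^{\wedge k}\to\Gamma^{\wedge(3-k)}$, $0\le k\le3$,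 with $$\langle x\omega,x'\omega'\rangle:=h(x^*x')\,\frac1{\lambda_k}\,g(\omega^*,\omega')=\int_\mu(x\omega)^*\wedge T(x'\omega')\qquad(x,x'\in\mathcal A,\ \omega,\omega'\in\Gamma^{\wedge k}_{\rm inv}),$$ and $T$ is left $\mathcal A$-linear. 3. For every real $m\ne0$: a contraction $g$ is non-degenerate, right $U(1)$-invariant, symmetric ($T^2=\zeta\cdot{\rm id}$ on $\Gamma$ for some $\zeta\in\mathbb C$) and real ($T(\omega_a^*)=(T\omega_a)^*$ for $a=\pm,z$) if and only if it is of the form in 1 with $\beta=q^6\alpha\in\mathbb R$, $\gamma\in\mathbb R$, $\alpha\gamma\ne0$. 4. For $g$ as in 3 and every real $m\neq 0$, one has $T(1)=\mu$ and $$\begin{aligned}T(\omega_-)&=-q^{-2}m\beta\,\omega_-\wedge\omega_z,& T(\omega_-\wedge\omega_z)&=2q^{-4}\lambda_2^{-1}m\beta\gamma\,\omega_-,\\ T(\omega_+)&=m\alpha\,\omega_+\wedge\omega_z,& T(\omega_+\wedge\omega_z)&=-2q^6\lambda_2^{-1}m\alpha\gamma\,\omega_+,\\ T(\omega_z)&=m\gamma\,\omega_-\wedge\omega_+,&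 T(\omega_-\wedge\omega_+)&=-2\lambda_2^{-1}m\alpha\beta\,\omega_z,\end{aligned}$$ and $T(\theta)=-6q^4\lambda_3^{-1}m\alpha\beta\gamma$. The determinant $\det g=\langle\mu,\mu\rangle$ is real and ${\rm sgn}(g):={\rm sgn}(\det g)=-{\rm sgn}(\gamma)$. If $T^2(1)={\rm sgn}(g)$, then $T^2(\omega_a)={\rm sgn}(g)\,\dfrac{2\lambda_3}{6q^4\lambda_2}\,\omega_a$ for $a=\pm,z$. 5. For $g$ as in 3, the normalisation $T^2(1)={\rm sgn}(g)$ fixes the modulus of $m$: there is $r>0$, depending only on $g$ and $q$, such that for real $m\ne0$ it holds if and only if $|m|=r$. -/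

import Mathlib

open scoped BigOperators

noncomputable section

namespace QHodge

/-- The four `*`-algebra generators `a, a*, c, c*` of the polynomial algebra of `SU_q(2)`. -/
inductive Gen
  | a | aStar | c | cStar

/-- The involution on generators. -/
def Gen.bar : Gen → Gen
  | .a => .aStar
  | .aStar => .a
  | .c => .cStar
  | .cStar => .c

/-- The deformation parameter, as a complex number. -/
def qC (q : Set.Ioo (0 : ℝ) 1) : ℂ := ((q : ℝ) : ℂ)

/-- The defining matrix `u = (a, -q c*; c, a*)`, over the free algebra. -/
def freeU (q : Set.Ioo (0 : ℝ) 1) : Matrix (Fin 2) (Fin 2) (FreeAlgebra ℂ Gen) :=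
  !![FreeAlgebra.ι ℂ Gen.a, -(qC q • FreeAlgebra.ι ℂ Gen.cStar);
     FreeAlgebra.ι ℂ Gen.c, FreeAlgebra.ι ℂ Gen.aStar]

/-- The conjugate transpose `u* = (a*, c*; -q c, a)`, over the free algebra. -/
def freeUStar (q : Set.Ioo (0 : ℝ) 1) : Matrix (Fin 2) (Fin 2) (FreeAlgebra ℂ Gen) :=
  !![FreeAlgebra.ι ℂ Gen.aStar, FreeAlgebra.ι ℂ Gen.cStar;
     -(qC q • FreeAlgebra.ι ℂ Gen.c), FreeAlgebra.ι ℂ Gen.a]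

/-- The defining relations `u u* = 1 = u* u`. -/
inductive Rel (q : Set.Ioo (0 : ℝ) 1) : FreeAlgebra ℂ Gen → FreeAlgebra ℂ Gen → Prop
  | mul_star (i j : Fin 2) :
      Rel q ((freeU q * freeUStar q) i j) ((1 : Matrix (Fin 2) (Fin 2) (FreeAlgebra ℂ Gen)) i j)
  | star_mul (i j : Fin 2) :
      Rel q ((freeUStar q * freeU q) i j) ((1 : Matrix (Fin 2) (Fin 2) (FreeAlgebra ℂ Gen)) i j)

/-- The polynomial algebra `A(SU_q(2))`. -/
def SUq (q : Set.Ioo (0 : ℝ) 1) : Type := RingQuot (Rel q)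

instance (q : Set.Ioo (0 : ℝ) 1) : Ring (SUq q) := inferInstanceAs (Ring (RingQuot (Rel q)))

instance (q : Set.Ioo (0 : ℝ) 1) : Algebra ℂ (SUq q) :=
  inferInstanceAs (Algebra ℂ (RingQuot (Rel q)))

/-- The class of a generator in `A(SU_q(2))`. -/
def gen (q : Set.Ioo (0 : ℝ) 1) (g : Gen) : SUq q :=
  RingQuot.mkAlgHom ℂ (Rel q) (FreeAlgebra.ι ℂ g)

/-- `f` respects the relations of `A(SU_q(2))`. -/
structure Relations (q : Set.Ioo (0 : ℝ) 1) {B : Type*} [Ring B] [Algebra ℂ B] (f : Gen → B) :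
    Prop where
  ac : f .a * f .c = qC q • (f .c * f .a)
  acs : f .a * f .cStar = qC q • (f .cStar * f .a)
  cas : f .c * f .aStar = qC q • (f .aStar * f .c)
  csas : f .cStar * f .aStar = qC q • (f .aStar * f .cStar)
  ccs : f .c * f .cStar = f .cStar * f .c
  asa : f .aStar * f .a + f .cStar * f .c = 1
  aas : f .a * f .aStar + qC q ^ 2 • (f .cStar * f .c) = 1

theorem gen_relations (q : Set.Ioo (0 : ℝ) 1) : Relations q (gen q) := by
  have h1 := fun i j => RingQuot.mkAlgHom_rel ℂ (Rel.mul_star (q := q) i j)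
  have h2 := fun i j => RingQuot.mkAlgHom_rel ℂ (Rel.star_mul (q := q) i j)
  have e1 := h1 0 0
  have e2 := h1 0 1
  have e3 := h1 1 0
  have e4 := h1 1 1
  have e5 := h2 0 0
  have e6 := h2 0 1
  have e7 := h2 1 0
  have e8 := h2 1 1
  simp [Matrix.mul_apply, freeU, freeUStar, Fin.sum_univ_two] at e1 e2 e3 e4 e5 e6 e7 e8
  change gen q .a * gen q .aStar + qC q • qC q • (gen q .cStar * gen q .c) = (1 : SUq q) at e1
  change gen q .a * gen q .cStar + -(qC q • (gen q .cStar * gen q .a)) = (0 : SUq q) at e2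
  change gen q .c * gen q .aStar + -(qC q • (gen q .aStar * gen q .c)) = (0 : SUq q) at e3
  change gen q .c * gen q .cStar + gen q .aStar * gen q .a = (1 : SUq q) at e4
  change gen q .aStar * gen q .a + gen q .cStar * gen q .c = (1 : SUq q) at e5
  change -(qC q • (gen q .aStar * gen q .cStar)) + gen q .cStar * gen q .aStar = (0 : SUq q) at e6
  change -(qC q • (gen q .c * gen q .a)) + gen q .a * gen q .c = (0 : SUq q) at e7
  refine ⟨?_, ?_, ?_, ?_, ?_, e5, ?_⟩
  · rwa [neg_add_eq_zero, eq_comm] at e7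
  · rwa [← sub_eq_add_neg, sub_eq_zero] at e2
  · rwa [← sub_eq_add_neg, sub_eq_zero] at e3
  · rwa [neg_add_eq_zero, eq_comm] at e6
  · rw [← e5, add_comm] at e4
    exact add_left_cancel e4
  · rwa [pow_two, mul_smul]

/-- The universal property of `A(SU_q(2))`. -/
def algLift (q : Set.Ioo (0 : ℝ) 1) {B : Type*} [Ring B] [Algebra ℂ B] (f : Gen → B)
    (hf : Relations q f) : SUq q →ₐ[ℂ] B :=
  RingQuot.liftAlgHom ℂ ⟨FreeAlgebra.lift ℂ f, by
    have h8 : f .a * f .aStar + qC q • qC q • (f .cStar * f .c) = 1 := by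
      rw [← mul_smul, ← pow_two]; exact hf.aas
    rintro _ _ (⟨i, j⟩ | ⟨i, j⟩) <;> fin_cases i <;> fin_cases j <;>
      simp [Matrix.mul_apply, freeU, freeUStar, Fin.sum_univ_two, hf.ac, hf.acs, hf.cas, hf.csas,
        hf.ccs, hf.asa, h8, add_comm]⟩

@[simp] theorem algLift_gen (q : Set.Ioo (0 : ℝ) 1) {B : Type*} [Ring B] [Algebra ℂ B] (f : Gen → B)
    (hf : Relations q f) (g : Gen) : algLift q f hf (gen q g) = f g := by
  simp only [algLift, gen]
  erw [RingQuot.liftAlgHom_mkAlgHom_apply]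
  simp

theorem algInduction (q : Set.Ioo (0 : ℝ) 1) {P : SUq q → Prop}
    (scalar : ∀ t : ℂ, P (algebraMap ℂ (SUq q) t)) (generator : ∀ g, P (gen q g))
    (mul : ∀ x y, P x → P y → P (x * y)) (add : ∀ x y, P x → P y → P (x + y)) (x : SUq q) :
    P x := by
  obtain ⟨y, rfl⟩ := RingQuot.mkAlgHom_surjective ℂ (Rel q) x
  induction y using FreeAlgebra.induction with
  | grade0 r => rw [AlgHom.commutes]; exact scalar r
  | grade1 g => exact generator g
  | mul x y hx hy => rw [map_mul]; exact mul _ _ hx hy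
  | add x y hx hy => rw [map_add]; exact add _ _ hx hy

/-! The `*`-structure. -/

/-- The opposite algebra, with `ℂ` acting through complex conjugation. -/
def ConjOp (q : Set.Ioo (0 : ℝ) 1) : Type := (SUq q)ᵐᵒᵖ

instance (q : Set.Ioo (0 : ℝ) 1) : Ring (ConjOp q) := inferInstanceAs (Ring (SUq q)ᵐᵒᵖ)

instance (q : Set.Ioo (0 : ℝ) 1) : Algebra ℂ (ConjOp q) :=
  Algebra.compHom (SUq q)ᵐᵒᵖ (starRingEnd ℂ)

/-- The identity map from the algebra to its conjugate opposite. -/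
def toConj (q : Set.Ioo (0 : ℝ) 1) (x : SUq q) : ConjOp q := MulOpposite.op x

theorem relations_conj (q : Set.Ioo (0 : ℝ) 1) :
    Relations q (fun g => toConj q (gen q g.bar)) := by
  have hc : starRingEnd ℂ (qC q) = qC q := Complex.conj_ofReal _
  have h := gen_relations q
  have hs : ∀ (t : ℂ) (x : SUq q), t • toConj q x = toConj q (starRingEnd ℂ t • x) :=
    fun t x => rfl
  have hm : ∀ x y : SUq q, toConj q x * toConj q y = toConj q (y * x) := fun x y => rfl
  have ha : ∀ x y : SUq q, toConj q x + toConj q y = toConj q (x + y) := fun x y => rfl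
  have h1 : (1 : ConjOp q) = toConj q 1 := rfl
  constructor <;> simp only [hs, hm, ha, h1, hc, map_pow, Gen.bar]
  · rw [h.csas]
  · rw [h.cas]
  · rw [h.acs]
  · rw [h.ac]
  · rw [h.ccs]
  · rw [h.asa]
  · rw [h.aas]

/-- The antimultiplicative conjugate-linear map exchanging `a, a*` and `c, c*`. -/
def starHom (q : Set.Ioo (0 : ℝ) 1) : SUq q →ₐ[ℂ] ConjOp q :=
  algLift q _ (relations_conj q)

instance (q : Set.Ioo (0 : ℝ) 1) : Star (SUq q) :=
  ⟨fun x => MulOpposite.unop (show (SUq q)ᵐᵒᵖ from starHom q x)⟩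

theorem star_gen (q : Set.Ioo (0 : ℝ) 1) (g : Gen) : star (gen q g) = gen q g.bar :=
  congrArg (fun y : ConjOp q => MulOpposite.unop (show (SUq q)ᵐᵒᵖ from y))
    (algLift_gen q _ (relations_conj q) g)

theorem star_scalar (q : Set.Ioo (0 : ℝ) 1) (t : ℂ) :
    star (algebraMap ℂ (SUq q) t) = algebraMap ℂ (SUq q) (starRingEnd ℂ t) :=
  congrArg (fun y : ConjOp q => MulOpposite.unop (show (SUq q)ᵐᵒᵖ from y))
    ((starHom q).commutes t)

theorem star_mul_rev (q : Set.Ioo (0 : ℝ) 1) (x y : SUq q) : star (x * y) = star y * star x :=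
  congrArg (fun y : ConjOp q => MulOpposite.unop (show (SUq q)ᵐᵒᵖ from y))
    (map_mul (starHom q) x y)

theorem star_add_eq (q : Set.Ioo (0 : ℝ) 1) (x y : SUq q) : star (x + y) = star x + star y :=
  congrArg (fun y : ConjOp q => MulOpposite.unop (show (SUq q)ᵐᵒᵖ from y))
    (map_add (starHom q) x y)

instance (q : Set.Ioo (0 : ℝ) 1) : StarRing (SUq q) where
  star_involutive x := by
    induction x using algInduction with
    | scalar t => rw [star_scalar, star_scalar, Complex.conj_conj]
    | generator g => rw [star_gen, star_gen]; cases g <;> rfl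
    | mul x y hx hy => rw [star_mul_rev, star_mul_rev, hx, hy]
    | add x y hx hy => rw [star_add_eq, star_add_eq, hx, hy]
  star_mul := star_mul_rev q
  star_add := star_add_eq q

instance (q : Set.Ioo (0 : ℝ) 1) : StarModule ℂ (SUq q) where
  star_smul t x := by
    rw [Algebra.smul_def, star_mul, star_scalar, Algebra.smul_def]
    exact (Algebra.commutes _ _).symm

/-! The right coaction of `U(1)`. -/

theorem relations_rot (q : Set.Ioo (0 : ℝ) 1) (t : ℂˣ) :
    Relations q (fun g : Gen => match g with
      | .a => (t : ℂ) • gen q .a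
      | .c => (t : ℂ) • gen q .c
      | .aStar => ((t⁻¹ : ℂˣ) : ℂ) • gen q .aStar
      | .cStar => ((t⁻¹ : ℂˣ) : ℂ) • gen q .cStar) := by
  have h := gen_relations q
  have h1 : (t : ℂ) * ((t⁻¹ : ℂˣ) : ℂ) = 1 := by simp
  have h2 : ((t⁻¹ : ℂˣ) : ℂ) * (t : ℂ) = 1 := by simp
  constructor <;> simp only [smul_mul_smul_comm, h1, h2, one_smul]
  · rw [h.ac, smul_comm]
  · rw [h.acs]
  · rw [h.cas]
  · rw [h.csas, smul_comm]
  · rw [h.ccs]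
  · rw [h.asa]
  · rw [h.aas]

/-- The right coaction `δ_R = (id ⊗ π) Δ` of `U(1)` evaluated at `z = t`: on generators,
`δ_R a = a ⊗ z`, `δ_R c = c ⊗ z`, `δ_R a* = a* ⊗ z⁻¹`, `δ_R c* = c* ⊗ z⁻¹`. -/
def rot (q : Set.Ioo (0 : ℝ) 1) (t : ℂˣ) : SUq q →ₐ[ℂ] SUq q :=
  algLift q _ (relations_rot q t)

/-- The charge `n` component `L_n = {x | δ_R x = x ⊗ z⁻ⁿ}`. -/
def charge (q : Set.Ioo (0 : ℝ) 1) (n : ℤ) : Submodule ℂ (SUq q) where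
  carrier := {x | ∀ t : ℂˣ, rot q t x = ((t ^ (-n) : ℂˣ) : ℂ) • x}
  add_mem' {x y} hx hy t := by rw [map_add, hx t, hy t, smul_add]
  zero_mem' t := by rw [map_zero, smul_zero]
  smul_mem' r x hx t := by rw [map_smul, hx t, smul_comm]

/-- The deformation parameter, as a unit of `ℂ`. -/
def qUnit (q : Set.Ioo (0 : ℝ) 1) : ℂˣ :=
  Units.mk0 (qC q) (Complex.ofReal_ne_zero.mpr q.2.1.ne')

/-- The automorphism of `A(SU_q(2))` that multiplies `L_n` by `q ^ (k n)`. -/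
def twist (q : Set.Ioo (0 : ℝ) 1) (k : ℕ) : SUq q →ₐ[ℂ] SUq q := rot q (qUnit q ^ (-(k : ℤ)))

theorem twist_of_mem_charge (q : Set.Ioo (0 : ℝ) 1) (k : ℕ) (n : ℤ) (x : SUq q)
    (hx : x ∈ charge q n) : twist q k x = qC q ^ ((k : ℤ) * n) • x := by
  rw [twist, hx, ← zpow_mul, neg_mul_neg, Units.val_zpow_eq_zpow_val]
  rfl

/-! The Haar state. -/

/-- The Hilbert space basis labels `(n, k)`, `n ≥ 0`, `k` an integer; finite vectors. -/
abbrev Vec : Type := (ℕ × ℤ) →₀ ℂ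

/-- The weighted shift `e_p ↦ r p • e_(f p)`. -/
def shift (r : ℕ × ℤ → ℝ) (f : ℕ × ℤ → ℕ × ℤ) : Module.End ℂ Vec :=
  Finsupp.lsum ℂ fun p => (r p : ℂ) • Finsupp.lsingle (f p)

theorem shift_single (r : ℕ × ℤ → ℝ) (f : ℕ × ℤ → ℕ × ℤ) (p : ℕ × ℤ) (z : ℂ) :
    shift r f (Finsupp.single p z) = Finsupp.single (f p) ((r p : ℂ) * z) := by
  simp [shift]

/-- Woronowicz's representation on generators: `a e_(n,k) = √(1 - q²ⁿ) e_(n-1,k)`,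
`c e_(n,k) = qⁿ e_(n,k+1)`, together with the adjoint operators. -/
def repGen (q : Set.Ioo (0 : ℝ) 1) : Gen → Module.End ℂ Vec
  | .a => shift (fun p => √(1 - (q : ℝ) ^ (2 * p.1))) (fun p => (p.1 - 1, p.2))
  | .aStar => shift (fun p => √(1 - (q : ℝ) ^ (2 * (p.1 + 1)))) (fun p => (p.1 + 1, p.2))
  | .c => shift (fun p => (q : ℝ) ^ p.1) (fun p => (p.1, p.2 + 1))
  | .cStar => shift (fun p => (q : ℝ) ^ p.1) (fun p => (p.1, p.2 - 1))

theorem sqrt_mul_self_pow (q : Set.Ioo (0 : ℝ) 1) (n : ℕ) :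
    ((√(1 - (q : ℝ) ^ (2 * n)) : ℝ) : ℂ) * ((√(1 - (q : ℝ) ^ (2 * n)) : ℝ) : ℂ)
      = 1 - (q : ℂ) ^ (2 * n) := by
  have h : (q : ℝ) ^ (2 * n) ≤ 1 := pow_le_one₀ q.2.1.le q.2.2.le
  rw [← Complex.ofReal_mul, Real.mul_self_sqrt (by linarith)]
  push_cast
  rfl

theorem relations_rep (q : Set.Ioo (0 : ℝ) 1) : Relations q (repGen q) := by
  have key : ∀ A B : Module.End ℂ Vec, (∀ p : ℕ × ℤ, A (Finsupp.single p 1) =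
      B (Finsupp.single p 1)) → A = B := fun A B h => by
    ext p : 2
    exact h p
  constructor <;> refine key _ _ ?_ <;> rintro ⟨n, k⟩ <;>
    simp only [repGen, Module.End.mul_apply, LinearMap.smul_apply, LinearMap.add_apply,
      shift_single, Module.End.one_apply, Finsupp.smul_single, mul_one, smul_eq_mul]
  · refine congrArg₂ Finsupp.single rfl ?_
    cases n with
    | zero => simp
    | succ n => simp only [qC, pow_succ, Nat.add_sub_cancel]; push_cast; ring
  · refine congrArg₂ Finsupp.single rfl ?_
    cases n with
    | zero => simp
    | succ n => simp only [qC, pow_succ, Nat.add_sub_cancel]; push_cast; ring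
  · refine congrArg₂ Finsupp.single rfl ?_
    simp only [qC, pow_succ]; push_cast; ring
  · refine congrArg₂ Finsupp.single rfl ?_
    simp only [qC, pow_succ]; push_cast; ring
  · refine congrArg₂ Finsupp.single ?_ rfl
    simp
  · cases n with
    | zero => simp
    | succ n =>
      simp only [Nat.add_sub_cancel, add_sub_cancel_right, sqrt_mul_self_pow]
      rw [← Finsupp.single_add]
      refine congrArg₂ Finsupp.single rfl ?_
      push_cast; ring
  · simp only [Nat.add_sub_cancel, add_sub_cancel_right, sqrt_mul_self_pow]
    rw [← Finsupp.single_add]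
    refine congrArg₂ Finsupp.single rfl ?_
    simp only [qC]; push_cast; ring

/-- Woronowicz's representation of `A(SU_q(2))` on finite vectors. -/
def rep (q : Set.Ioo (0 : ℝ) 1) : SUq q →ₐ[ℂ] Module.End ℂ Vec := algLift q _ (relations_rep q)

/-- The `ℓ¹` norm of a finite vector. -/
def norm1 (v : Vec) : ℝ := v.sum fun _ z => ‖z‖

theorem norm1_nonneg (v : Vec) : 0 ≤ norm1 v := Finset.sum_nonneg fun _ _ => norm_nonneg _

theorem norm1_add (u v : Vec) : norm1 (u + v) ≤ norm1 u + norm1 v := by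
  classical
  have e : ∀ w : Vec, w.support ⊆ u.support ∪ v.support →
      norm1 w = ∑ p ∈ u.support ∪ v.support, ‖w p‖ := fun w hw =>
    Finsupp.sum_of_support_subset w hw _ (by simp)
  rw [e _ Finsupp.support_add, e u Finset.subset_union_left, e v Finset.subset_union_right,
    ← Finset.sum_add_distrib]
  exact Finset.sum_le_sum fun p _ => norm_add_le _ _

theorem norm1_single (p : ℕ × ℤ) (z : ℂ) : norm1 (Finsupp.single p z) = ‖z‖ := by
  simp [norm1]

theorem norm1_map_le (L : Module.End ℂ Vec) (C : ℝ)
    (h : ∀ p z, norm1 (L (Finsupp.single p z)) ≤ C * ‖z‖) (v : Vec) :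
    norm1 (L v) ≤ C * norm1 v := by
  classical
  induction v using Finsupp.induction with
  | zero => simp [norm1]
  | single_add p z f hp hz ih =>
    have e : norm1 (Finsupp.single p z + f) = ‖z‖ + norm1 f := by
      rw [norm1, Finsupp.sum_add_index_of_disjoint, Finsupp.sum_single_index (by simp)]
      · rfl
      · rw [Finsupp.support_single p hz]
        simpa using hp
    rw [map_add, e, mul_add]
    exact (norm1_add _ _).trans (add_le_add (h p z) ih)

theorem rep_bounded (q : Set.Ioo (0 : ℝ) 1) (x : SUq q) :
    ∃ C : ℝ, 0 ≤ C ∧ ∀ v, norm1 (rep q x v) ≤ C * norm1 v := by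
  have hs : ∀ (r : ℕ × ℤ → ℝ) (f : ℕ × ℤ → ℕ × ℤ), (∀ p, |r p| ≤ 1) →
      ∀ v, norm1 (shift r f v) ≤ 1 * norm1 v := fun r f hr v =>
    norm1_map_le _ 1 (fun p z => by
      rw [shift_single, norm1_single, norm_mul, Complex.norm_real]
      exact mul_le_mul_of_nonneg_right (hr p) (norm_nonneg z)) v
  have hp : ∀ n : ℕ, 0 ≤ (q : ℝ) ^ n ∧ (q : ℝ) ^ n ≤ 1 := fun n =>
    ⟨pow_nonneg q.2.1.le n, pow_le_one₀ q.2.1.le q.2.2.le⟩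
  have hq : ∀ n : ℕ, |√(1 - (q : ℝ) ^ n)| ≤ 1 := fun n => by
    rw [abs_of_nonneg (Real.sqrt_nonneg _)]
    exact Real.sqrt_le_one.mpr (by linarith [(hp n).1])
  have hq' : ∀ n : ℕ, |(q : ℝ) ^ n| ≤ 1 := fun n => by
    rw [abs_of_nonneg (hp n).1]
    exact (hp n).2
  induction x using algInduction with
  | scalar t =>
    refine ⟨‖t‖, norm_nonneg t, norm1_map_le _ _ fun p z => ?_⟩
    rw [AlgHom.commutes, Module.algebraMap_end_apply, Finsupp.smul_single, norm1_single, norm_smul]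
  | generator g =>
    refine ⟨1, zero_le_one, ?_⟩
    rw [rep, algLift_gen]
    cases g
    · exact hs _ _ fun p => hq _
    · exact hs _ _ fun p => hq _
    · exact hs _ _ fun p => hq' _
    · exact hs _ _ fun p => hq' _
  | mul x y hx hy =>
    obtain ⟨C, hC, hx⟩ := hx
    obtain ⟨D, hD, hy⟩ := hy
    refine ⟨C * D, mul_nonneg hC hD, fun v => ?_⟩
    rw [map_mul, mul_assoc]
    exact (hx _).trans (mul_le_mul_of_nonneg_left (hy v) hC)
  | add x y hx hy =>
    obtain ⟨C, hC, hx⟩ := hx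
    obtain ⟨D, hD, hy⟩ := hy
    refine ⟨C + D, add_nonneg hC hD, fun v => ?_⟩
    rw [map_add, add_mul]
    exact (norm1_add _ _).trans (add_le_add (hx v) (hy v))

/-- The summand `q²ⁿ ⟨e_(n,0), x e_(n,0)⟩`. -/
def haarTerm (q : Set.Ioo (0 : ℝ) 1) (x : SUq q) (n : ℕ) : ℂ :=
  qC q ^ (2 * n) * rep q x (Finsupp.single (n, 0) 1) (n, 0)

theorem haarTerm_summable (q : Set.Ioo (0 : ℝ) 1) (x : SUq q) : Summable (haarTerm q x) := by
  obtain ⟨C, hC, h⟩ := rep_bounded q x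
  have hq2 : (q : ℝ) ^ 2 < 1 := pow_lt_one₀ q.2.1.le q.2.2 two_ne_zero
  refine Summable.of_norm_bounded (g := fun n => C * ((q : ℝ) ^ 2) ^ n)
    ((summable_geometric_of_lt_one (sq_nonneg _) hq2).mul_left C) fun n => ?_
  have h1 : ∀ (v : Vec) (p : ℕ × ℤ), ‖v p‖ ≤ norm1 v := fun v p => by
    by_cases hp : p ∈ v.support
    · exact Finset.single_le_sum (f := fun p => ‖v p‖) (fun _ _ => norm_nonneg _) hp
    · rw [Finsupp.notMem_support_iff.mp hp, norm_zero]
      exact norm1_nonneg v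
  have h2 := (h1 _ (n, 0)).trans (h (Finsupp.single (n, 0) 1))
  rw [norm1_single, norm_one, mul_one] at h2
  rw [haarTerm, norm_mul, qC, norm_pow, Complex.norm_real, Real.norm_of_nonneg q.2.1.le, mul_comm,
    pow_mul]
  exact mul_le_mul_of_nonneg_right h2 (pow_nonneg (sq_nonneg _) n)

/-- The Haar state `h(x) = (1 - q²) ∑ₙ q²ⁿ ⟨e_(n,0), x e_(n,0)⟩` of `SU_q(2)`. -/
def haar (q : Set.Ioo (0 : ℝ) 1) : SUq q →ₗ[ℂ] ℂ where
  toFun x := (1 - qC q ^ 2) * ∑' n, haarTerm q x n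
  map_add' x y := by
    rw [← mul_add, ← (haarTerm_summable q x).tsum_add (haarTerm_summable q y)]
    simp [haarTerm, mul_add]
  map_smul' t x := by
    have : ∀ n, haarTerm q (t • x) n = t * haarTerm q x n := fun n => by
      simp [haarTerm]; ring
    simp only [this, tsum_mul_left, smul_eq_mul, RingHom.id_apply]
    ring

theorem haar_one (q : Set.Ioo (0 : ℝ) 1) : haar q 1 = 1 := by
  have hq2 : (q : ℝ) ^ 2 < 1 := pow_lt_one₀ q.2.1.le q.2.2 two_ne_zero
  have h : ‖qC q ^ 2‖ < 1 := by
    rwa [qC, norm_pow, Complex.norm_real, Real.norm_of_nonneg q.2.1.le]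
  have h1 : (1 : ℂ) - qC q ^ 2 ≠ 0 := fun e => by
    rw [← sub_eq_zero.mp e, norm_one] at h
    exact lt_irrefl _ h
  change (1 - qC q ^ 2) * ∑' n, haarTerm q 1 n = 1
  simp only [haarTerm, map_one, Module.End.one_apply, Finsupp.single_eq_same, mul_one, pow_mul]
  rw [tsum_geometric_of_norm_lt_one h, mul_inv_cancel₀ h1]

/-! Left-invariant forms, the braiding and the antisymmetrisers. -/

/-- The labels of the basis `ω_-, ω_+, ω_z` of the left-invariant 1-forms. -/
inductive Idx
  | minus | plus | zed
  deriving DecidableEq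

instance : Fintype Idx := ⟨{.minus, .plus, .zed}, fun a => by cases a <;> decide⟩

/-- `ω_a* = -ω_(bar a)`. -/
def Idx.bar : Idx → Idx
  | .minus => .plus
  | .plus => .minus
  | .zed => .zed

/-- The right module structure: `ω_a x = q ^ (weight a * n) x ω_a` for `x` in `L_n`. -/
def Idx.weight : Idx → ℕ
  | .minus => 1
  | .plus => 1
  | .zed => 2

/-- The right `U(1)`-coaction: `ω_a ↦ ω_a ⊗ z ^ (degree a)`. -/
def Idx.degree : Idx → ℤ
  | .minus => -2
  | .plus => 2
  | .zed => 0

/-- Labels of the basis `ω_(w 0) ⊗ ⋯ ⊗ ω_(w (k-1))` of the `k`-fold tensor power. -/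
abbrev Word (k : ℕ) : Type := Fin k → Idx

/-- `braid q a b p` is the coefficient of `ω_p.1 ⊗ ω_p.2` in `σ(ω_a ⊗ ω_b)`. -/
def braid (q : Set.Ioo (0 : ℝ) 1) : Idx → Idx → Idx × Idx → ℝ
  | .minus, .minus => Pi.single (.minus, .minus) 1
  | .plus, .plus => Pi.single (.plus, .plus) 1
  | .zed, .zed => Pi.single (.zed, .zed) 1
  | .minus, .plus =>
      (1 - (q : ℝ) ^ 2) • Pi.single (.minus, .plus) 1
        + ((q : ℝ) ^ 2)⁻¹ • Pi.single (.plus, .minus) 1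
  | .plus, .minus => (q : ℝ) ^ 4 • Pi.single (.minus, .plus) 1
  | .minus, .zed =>
      (1 - (q : ℝ) ^ 2) • Pi.single (.minus, .zed) 1
        + ((q : ℝ) ^ 4)⁻¹ • Pi.single (.zed, .minus) 1
  | .zed, .minus => (q : ℝ) ^ 6 • Pi.single (.minus, .zed) 1
  | .zed, .plus =>
      (1 - (q : ℝ) ^ 2) • Pi.single (.zed, .plus) 1
        + ((q : ℝ) ^ 4)⁻¹ • Pi.single (.plus, .zed) 1
  | .plus, .zed => (q : ℝ) ^ 6 • Pi.single (.zed, .plus) 1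

/-- The braiding acting on the tensor factors `i` and `j` of a tensor with coefficients in `R`. -/
def braidAt (q : Set.Ioo (0 : ℝ) 1) (R : Type*) [Ring R] [Algebra ℂ R] {k : ℕ} (i j : Fin k) :
    Module.End R (Word k → R) where
  toFun s w := ∑ p : Idx × Idx, (braid q p.1 p.2 (w i, w j) : ℂ) •
    s (Function.update (Function.update w i p.1) j p.2)
  map_add' s t := by
    funext w
    simp [Finset.sum_add_distrib]
  map_smul' r s := by
    funext w
    simp [Finset.mul_sum]

/-- The antisymmetrisers `A⁽ᵏ⁾`; the exterior algebra ends in degree three. -/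
def asym (q : Set.Ioo (0 : ℝ) 1) (R : Type*) [Ring R] [Algebra ℂ R] :
    (k : ℕ) → Module.End R (Word k → R)
  | 0 => 1
  | 1 => 1
  | 2 => 1 - braidAt q R 0 1
  | 3 => (1 - braidAt q R 1 2) * (1 - braidAt q R 0 1 + braidAt q R 0 1 * braidAt q R 1 2)
  | _ + 4 => 0

/-- The eigenvalue `λ_k` of `A⁽ᵏ⁾` on its range. -/
def lam (q : Set.Ioo (0 : ℝ) 1) : ℕ → ℝ
  | 2 => 1 + (q : ℝ) ^ 2
  | 3 => 1 + 2 * (q : ℝ) ^ 2 + 2 * (q : ℝ) ^ 4 + (q : ℝ) ^ 6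
  | _ => 1

theorem Idx.sum_eq {M : Type*} [AddCommMonoid M] (f : Idx → M) :
    ∑ a, f a = f .minus + (f .plus + f .zed) := by
  change ∑ a ∈ {Idx.minus, Idx.plus, Idx.zed}, f a = _
  rw [Finset.sum_insert (by decide), Finset.sum_insert (by decide), Finset.sum_singleton]

theorem word3 (w : Word 3) : ∃ a b c, w = ![a, b, c] :=
  ⟨w 0, w 1, w 2, by funext i; fin_cases i <;> rfl⟩

section
variable (q : Set.Ioo (0 : ℝ) 1) {R : Type*} [Ring R] [Algebra ℂ R]

theorem braid_sum {M : Type*} [AddCommGroup M] [Module ℂ M] (F : Idx × Idx → M) (p : Idx × Idx) :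
    ∑ r : Idx × Idx, (braid q r.1 r.2 p : ℂ) • F r = match p with
      | (.minus, .minus) => F (.minus, .minus)
      | (.plus, .plus) => F (.plus, .plus)
      | (.zed, .zed) => F (.zed, .zed)
      | (.minus, .plus) => (1 - qC q ^ 2) • F (.minus, .plus) + qC q ^ 4 • F (.plus, .minus)
      | (.plus, .minus) => (qC q ^ 2)⁻¹ • F (.minus, .plus)
      | (.minus, .zed) => (1 - qC q ^ 2) • F (.minus, .zed) + qC q ^ 6 • F (.zed, .minus)
      | (.zed, .minus) => (qC q ^ 4)⁻¹ • F (.minus, .zed)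
      | (.zed, .plus) => (1 - qC q ^ 2) • F (.zed, .plus) + qC q ^ 6 • F (.plus, .zed)
      | (.plus, .zed) => (qC q ^ 4)⁻¹ • F (.zed, .plus) := by
  obtain ⟨a, b⟩ := p
  cases a <;> cases b <;>
    simp [Fintype.sum_prod_type, Idx.sum_eq, braid, qC, ← Complex.ofReal_pow,
      ← Complex.ofReal_one, ← Complex.ofReal_sub, -Complex.coe_smul] <;>
    first
      | exact add_comm _ _
      | rw [Complex.ofReal_one, one_smul]

theorem braidAt_01 (s : Word 3 → R) (a b c : Idx) : braidAt q R 0 1 s ![a, b, c] =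
    ∑ p : Idx × Idx, (braid q p.1 p.2 (a, b) : ℂ) • (fun p : Idx × Idx => s ![p.1, p.2, c]) p := by
  simp only [braidAt, LinearMap.coe_mk, AddHom.coe_mk]
  refine Finset.sum_congr rfl fun p _ => ?_
  have : Function.update (Function.update ![a, b, c] (0 : Fin 3) p.1) 1 p.2 = ![p.1, p.2, c] := by
    funext i; fin_cases i <;> rfl
  simp only [this]
  rfl

theorem braidAt_12 (s : Word 3 → R) (a b c : Idx) : braidAt q R 1 2 s ![a, b, c] =
    ∑ p : Idx × Idx, (braid q p.1 p.2 (b, c) : ℂ) • (fun p : Idx × Idx => s ![a, p.1, p.2]) p := by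
  simp only [braidAt, LinearMap.coe_mk, AddHom.coe_mk]
  refine Finset.sum_congr rfl fun p _ => ?_
  have : Function.update (Function.update ![a, b, c] (1 : Fin 3) p.1) 2 p.2 = ![a, p.1, p.2] := by
    funext i; fin_cases i <;> rfl
  simp only [this]
  rfl

theorem braid_relation : braidAt q R (0 : Fin 3) 1 * braidAt q R 1 2 * braidAt q R 0 1 =
    braidAt q R 1 2 * braidAt q R 0 1 * braidAt q R 1 2 := by
  have hq : qC q ≠ 0 := Complex.ofReal_ne_zero.mpr q.2.1.ne'
  refine LinearMap.ext fun s => funext fun w => ?_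
  obtain ⟨a, b, c, rfl⟩ := word3 w
  simp only [Module.End.mul_apply]
  cases a <;> cases b <;> cases c <;> simp only [braidAt_01, braidAt_12, braid_sum] <;>
    match_scalars <;> field_simp <;> ring

end

/-! Forms, involution and wedge product. -/

/-- The total weight of a word. -/
def weight {k : ℕ} (w : Word k) : ℕ := ∑ i, (w i).weight

theorem weight_update {k : ℕ} (w : Word k) (i : Fin k) (a : Idx) :
    weight (Function.update w i a) + (w i).weight = weight w + a.weight := by
  have h1 := Finset.add_sum_erase Finset.univ (fun l => (w l).weight) (Finset.mem_univ i)
  have h2 := Finset.add_sum_erase Finset.univ (fun l => (Function.update w i a l).weight)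
    (Finset.mem_univ i)
  have h3 : ∑ l ∈ Finset.univ.erase i, (Function.update w i a l).weight =
      ∑ l ∈ Finset.univ.erase i, (w l).weight := Finset.sum_congr rfl fun l hl => by
    rw [Function.update_of_ne (Finset.ne_of_mem_erase hl)]
  simp only [Function.update_self] at h2
  unfold weight
  omega

theorem weight_update_of_braid (q : Set.Ioo (0 : ℝ) 1) {k : ℕ} (w : Word k) {i j : Fin k}
    (hij : i ≠ j) {a b : Idx} (h : braid q a b (w i, w j) ≠ 0) :
    weight (Function.update (Function.update w i a) j b) = weight w := by
  have hwt : ∀ a b c d : Idx, braid q a b (c, d) ≠ 0 →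
      a.weight + b.weight = c.weight + d.weight := by
    intro a b c d
    cases a <;> cases b <;> cases c <;> cases d <;>
      simp [braid, Idx.weight]
  have h0 := hwt _ _ _ _ h
  have h1 := weight_update w i a
  have h2 := weight_update (Function.update w i a) j b
  rw [Function.update_of_ne hij.symm] at h2
  omega

/-- The antilinear involution of the `k`-fold tensor power:
`(ω_1 ⊗ ⋯ ⊗ ω_k)* = (-1) ^ (k (k - 1) / 2) ω_k* ⊗ ⋯ ⊗ ω_1*` and `(x ω)* = ω* x*`. -/
def starTensor (q : Set.Ioo (0 : ℝ) 1) {k : ℕ} (s : Word k → SUq q) : Word k → SUq q :=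
  fun w => (-1 : SUq q) ^ (k * (k - 1) / 2 + k) *
    twist q (weight w) (star (s fun i => (w i.rev).bar))

theorem starTensor_braidAt (q : Set.Ioo (0 : ℝ) 1) {k : ℕ} {i j : Fin k} (hij : i ≠ j)
    (s : Word k → SUq q) : starTensor q (braidAt q (SUq q) i j s) =
      braidAt q (SUq q) j.rev i.rev (starTensor q s) := by
  have hb : ∀ a : Idx, a.bar.bar = a := fun a => by cases a <;> rfl
  have hsym : ∀ a b c d : Idx, braid q b.bar a.bar (d.bar, c.bar) = braid q a b (c, d) := by
    intro a b c d
    cases a <;> cases b <;> cases c <;> cases d <;> simp [braid, Idx.bar]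
  let e : Idx × Idx ≃ Idx × Idx :=
    ⟨fun p => (p.2.bar, p.1.bar), fun p => (p.2.bar, p.1.bar), fun p => by simp [hb],
      fun p => by simp [hb]⟩
  have hr : j.rev ≠ i.rev := fun h => hij (Fin.rev_injective h).symm
  funext w
  simp only [starTensor, braidAt, LinearMap.coe_mk, AddHom.coe_mk]
  rw [star_sum, map_sum, Finset.mul_sum]
  refine Eq.trans ?_ (e.sum_comp _)
  refine Finset.sum_congr rfl fun p _ => ?_
  have h1 : braid q (e p).1 (e p).2 (w j.rev, w i.rev) =
      braid q p.1 p.2 ((w i.rev).bar, (w j.rev).bar) := by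
    rw [← hsym p.1 p.2, hb, hb]; rfl
  rw [h1, star_smul, map_smul, mul_smul_comm]
  by_cases h0 : braid q p.1 p.2 ((w i.rev).bar, (w j.rev).bar) = 0
  · simp [h0]
  have h2 : weight (Function.update (Function.update w j.rev (e p).1) i.rev (e p).2) =
      weight w := by
    rw [← h1] at h0
    exact weight_update_of_braid q w hr h0
  rw [h2]
  have h3 : (fun l : Fin k => (Function.update (Function.update w j.rev (e p).1) i.rev (e p).2
      l.rev).bar) = Function.update (Function.update (fun l => (w l.rev).bar) i p.1) j p.2 := by
    funext l
    rcases eq_or_ne l j with rfl | hj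
    · simp [Function.update_of_ne hr, e, hb]
    rcases eq_or_ne l i with rfl | hi
    · simp [Function.update_of_ne hij, e, hb]
    · rw [Function.update_of_ne (fun h => hi (Fin.rev_injective h)),
        Function.update_of_ne (fun h => hj (Fin.rev_injective h)), Function.update_of_ne hj,
        Function.update_of_ne hi]
  rw [h3]
  simp
section
variable (q : Set.Ioo (0 : ℝ) 1) {R : Type*} [Ring R] [Algebra ℂ R]

theorem word2 (w : Word 2) : ∃ a b, w = ![a, b] :=
  ⟨w 0, w 1, by funext i; fin_cases i <;> rfl⟩

theorem braidAt_two (s : Word 2 → R) (a b : Idx) : braidAt q R 0 1 s ![a, b] =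
    ∑ p : Idx × Idx, (braid q p.1 p.2 (a, b) : ℂ) • (fun p : Idx × Idx => s ![p.1, p.2]) p := by
  simp only [braidAt, LinearMap.coe_mk, AddHom.coe_mk]
  refine Finset.sum_congr rfl fun p _ => ?_
  have : Function.update (Function.update ![a, b] (0 : Fin 2) p.1) 1 p.2 = ![p.1, p.2] := by
    funext i; fin_cases i <;> rfl
  simp only [this]
  rfl

theorem hecke_two (s : Word 2 → R) : braidAt q R 0 1 (braidAt q R 0 1 s) =
    (1 - qC q ^ 2) • braidAt q R 0 1 s + qC q ^ 2 • s := by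
  have hq : qC q ≠ 0 := Complex.ofReal_ne_zero.mpr q.2.1.ne'
  refine funext fun w => ?_
  obtain ⟨a, b, rfl⟩ := word2 w
  cases a <;> cases b <;> simp only [braidAt_two, braid_sum, Pi.add_apply, Pi.smul_apply] <;>
    match_scalars <;> field_simp <;> ring

theorem hecke_01 (s : Word 3 → R) : braidAt q R 0 1 (braidAt q R 0 1 s) =
    (1 - qC q ^ 2) • braidAt q R 0 1 s + qC q ^ 2 • s := by
  have hq : qC q ≠ 0 := Complex.ofReal_ne_zero.mpr q.2.1.ne'
  refine funext fun w => ?_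
  obtain ⟨a, b, c, rfl⟩ := word3 w
  cases a <;> cases b <;> simp only [braidAt_01, braid_sum, Pi.add_apply, Pi.smul_apply] <;>
    match_scalars <;> field_simp <;> ring

theorem hecke_12 (s : Word 3 → R) : braidAt q R 1 2 (braidAt q R 1 2 s) =
    (1 - qC q ^ 2) • braidAt q R 1 2 s + qC q ^ 2 • s := by
  have hq : qC q ≠ 0 := Complex.ofReal_ne_zero.mpr q.2.1.ne'
  refine funext fun w => ?_
  obtain ⟨a, b, c, rfl⟩ := word3 w
  cases b <;> cases c <;> simp only [braidAt_12, braid_sum, Pi.add_apply, Pi.smul_apply] <;>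
    match_scalars <;> field_simp <;> ring

theorem asym_two (s : Word 2 → R) : asym q R 2 s = s - braidAt q R 0 1 s := rfl

theorem braidAt_smul {k : ℕ} (i j : Fin k) (t : ℂ) (s : Word k → R) :
    braidAt q R i j (t • s) = t • braidAt q R i j s := by
  funext w
  simp only [braidAt, LinearMap.coe_mk, AddHom.coe_mk, Pi.smul_apply, Finset.smul_sum]
  exact Finset.sum_congr rfl fun p _ => smul_comm _ _ _

theorem asym_two_braidAt (s : Word 2 → R) :
    asym q R 2 (braidAt q R 0 1 s) = -(qC q ^ 2 • asym q R 2 s) := by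
  simp only [asym_two, hecke_two]
  module

theorem asym_three (s : Word 3 → R) : asym q R 3 s =
    s - braidAt q R 0 1 s - braidAt q R 1 2 s + braidAt q R 0 1 (braidAt q R 1 2 s)
      + braidAt q R 1 2 (braidAt q R 0 1 s)
      - braidAt q R 1 2 (braidAt q R 0 1 (braidAt q R 1 2 s)) := by
  change (s - braidAt q R 0 1 s + braidAt q R 0 1 (braidAt q R 1 2 s)) -
    braidAt q R 1 2 (s - braidAt q R 0 1 s + braidAt q R 0 1 (braidAt q R 1 2 s)) = _
  simp only [map_add, map_sub]
  abel

theorem braid_relation_apply (s : Word 3 → R) :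
    braidAt q R 0 1 (braidAt q R 1 2 (braidAt q R 0 1 s)) =
      braidAt q R 1 2 (braidAt q R 0 1 (braidAt q R 1 2 s)) :=
  LinearMap.congr_fun (braid_relation q (R := R)) s

theorem asym_three_braidAt_12 (s : Word 3 → R) :
    asym q R 3 (braidAt q R 1 2 s) = -(qC q ^ 2 • asym q R 3 s) := by
  simp only [asym_three, hecke_12, map_add, braidAt_smul]
  module

theorem asym_three_braidAt_01 (s : Word 3 → R) :
    asym q R 3 (braidAt q R 0 1 s) = -(qC q ^ 2 • asym q R 3 s) := by
  simp only [asym_three, braid_relation_apply, hecke_01, map_add, braidAt_smul]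
  simp only [← braid_relation_apply, hecke_01, map_add, braidAt_smul]
  module

theorem asym_three_sub_01 (s : Word 3 → R) :
    asym q R 3 (s - braidAt q R 0 1 s) = (lam q 2 : ℂ) • asym q R 3 s := by
  rw [map_sub, asym_three_braidAt_01]
  simp only [lam, qC, Complex.ofReal_add, Complex.ofReal_one, Complex.ofReal_pow]
  module

theorem asym_three_sub_12 (s : Word 3 → R) :
    asym q R 3 (s - braidAt q R 1 2 s) = (lam q 2 : ℂ) • asym q R 3 s := by
  rw [map_sub, asym_three_braidAt_12]
  simp only [lam, qC, Complex.ofReal_add, Complex.ofReal_one, Complex.ofReal_pow]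
  module

theorem asym_smul (k : ℕ) (t : ℂ) (s : Word k → R) : asym q R k (t • s) = t • asym q R k s := by
  match k with
  | 0 => rfl
  | 1 => rfl
  | 2 => simp only [asym_two, braidAt_smul, smul_sub]
  | 3 => simp only [asym_three, braidAt_smul, smul_sub, smul_add]
  | _ + 4 => exact (smul_zero t).symm

/-- The antisymmetriser acts on its range by the scalar `λ_k`. -/
theorem asym_asym (k : ℕ) (s : Word k → R) :
    asym q R k (asym q R k s) = (lam q k : ℂ) • asym q R k s := by
  match k with
  | 0 => simp [asym, lam]
  | 1 => simp [asym, lam]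
  | 2 =>
    rw [asym_two q s, map_sub, asym_two_braidAt, asym_two]
    simp only [lam, qC, Complex.ofReal_add, Complex.ofReal_one, Complex.ofReal_pow]
    module
  | 3 =>
    nth_rewrite 2 [asym_three]
    simp only [map_add, map_sub, asym_three_braidAt_12, asym_three_braidAt_01]
    simp only [lam, qC, Complex.ofReal_add, Complex.ofReal_one, Complex.ofReal_pow,
      Complex.ofReal_mul, Complex.ofReal_ofNat]
    module
  | _ + 4 => exact (smul_zero _).symm

end

theorem starTensor_sub (q : Set.Ioo (0 : ℝ) 1) {k : ℕ} (s t : Word k → SUq q) :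
    starTensor q (s - t) = starTensor q s - starTensor q t := by
  funext w
  simp [starTensor, mul_sub]

theorem starTensor_add (q : Set.Ioo (0 : ℝ) 1) {k : ℕ} (s t : Word k → SUq q) :
    starTensor q (s + t) = starTensor q s + starTensor q t := by
  funext w
  simp [starTensor, mul_add]

theorem starTensor_asym (q : Set.Ioo (0 : ℝ) 1) (k : ℕ) (s : Word k → SUq q) :
    starTensor q (asym q (SUq q) k s) = asym q (SUq q) k (starTensor q s) := by
  have h2 := starTensor_braidAt q (k := 2) (i := 0) (j := 1) (by decide)
  have h01 := starTensor_braidAt q (k := 3) (i := 0) (j := 1) (by decide)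
  have h12 := starTensor_braidAt q (k := 3) (i := 1) (j := 2) (by decide)
  have r0 : (0 : Fin 3).rev = 2 := rfl
  have r1 : (1 : Fin 3).rev = 1 := rfl
  have r2 : (2 : Fin 3).rev = 0 := rfl
  have r3 : (0 : Fin 2).rev = 1 := rfl
  have r4 : (1 : Fin 2).rev = 0 := rfl
  rw [r3, r4] at h2
  rw [r0, r1] at h01
  rw [r1, r2] at h12
  match k with
  | 0 => rfl
  | 1 => rfl
  | 2 => rw [asym_two, asym_two, starTensor_sub, h2]
  | 3 =>
    simp only [asym_three, starTensor_sub, starTensor_add, h01, h12, braid_relation_apply]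
    abel
  | _ + 4 =>
    funext w
    simp [asym, starTensor]

/-- The `k`-forms `Γ^∧k = Range A⁽ᵏ⁾`, as a left module over `A(SU_q(2))`. -/
def forms (q : Set.Ioo (0 : ℝ) 1) (k : ℕ) : Submodule (SUq q) (Word k → SUq q) :=
  LinearMap.range (asym q (SUq q) k)

/-- The left-invariant `k`-forms. -/
def invForms (q : Set.Ioo (0 : ℝ) 1) (k : ℕ) : Submodule ℂ (Word k → ℂ) :=
  LinearMap.range (asym q ℂ k)

/-- The `*`-structure on `k`-forms. -/
def starForm (q : Set.Ioo (0 : ℝ) 1) {k : ℕ} (φ : forms q k) : forms q k :=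
  ⟨starTensor q φ, by
    obtain ⟨_, s, rfl⟩ := φ
    exact ⟨starTensor q s, (starTensor_asym q k s).symm⟩⟩

/-- The inclusion of tensors with constant coefficients. -/
def incl (q : Set.Ioo (0 : ℝ) 1) {k : ℕ} (ω : Word k → ℂ) : Word k → SUq q :=
  fun w => algebraMap ℂ (SUq q) (ω w)

theorem incl_braidAt (q : Set.Ioo (0 : ℝ) 1) {k : ℕ} (i j : Fin k) (s : Word k → ℂ) :
    incl q (braidAt q ℂ i j s) = braidAt q (SUq q) i j (incl q s) := by
  funext w
  simp [incl, braidAt, Algebra.smul_def, -Complex.coe_smul]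

theorem incl_asym (q : Set.Ioo (0 : ℝ) 1) (k : ℕ) (s : Word k → ℂ) :
    incl q (asym q ℂ k s) = asym q (SUq q) k (incl q s) := by
  have hs : ∀ {k : ℕ} (s t : Word k → ℂ), incl q (s - t) = incl q s - incl q t := fun s t => by
    funext w; simp [incl]
  have ha : ∀ {k : ℕ} (s t : Word k → ℂ), incl q (s + t) = incl q s + incl q t := fun s t => by
    funext w; simp [incl]
  match k with
  | 0 => rfl
  | 1 => rfl
  | 2 => rw [asym_two, asym_two, hs, incl_braidAt]
  | 3 => simp only [asym_three, hs, ha, incl_braidAt]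
  | _ + 4 =>
    funext w
    simp [asym, incl]

/-- The form `x ω`, for `x` in the algebra and `ω` a left-invariant form. -/
def form (q : Set.Ioo (0 : ℝ) 1) {k : ℕ} (x : SUq q) (ω : invForms q k) : forms q k :=
  x • ⟨incl q ω, by
    obtain ⟨_, s, rfl⟩ := ω
    exact ⟨incl q s, (incl_asym q k s).symm⟩⟩

/-- The `*`-structure on left-invariant tensors. -/
def starConst {k : ℕ} (s : Word k → ℂ) : Word k → ℂ :=
  fun w => (-1) ^ (k * (k - 1) / 2 + k) * starRingEnd ℂ (s fun i => (w i.rev).bar)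

theorem incl_starConst (q : Set.Ioo (0 : ℝ) 1) {k : ℕ} (s : Word k → ℂ) :
    incl q (starConst s) = starTensor q (incl q s) := by
  funext w
  simp only [incl, starConst, starTensor, star_scalar, AlgHom.commutes, map_mul, map_pow, map_neg,
    map_one]

/-- The tensor product over `A(SU_q(2))` :
`(x ω_v) ⊗ (y ω_w) = x y' ω_v ⊗ ω_w` where `ω_v y = y' ω_v`. -/
def tensorMul (q : Set.Ioo (0 : ℝ) 1) {k l : ℕ} (s : Word k → SUq q) (t : Word l → SUq q) :
    Word (k + l) → SUq q :=
  fun w => s (fun i => w (Fin.castAdd l i)) *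
    twist q (weight fun i => w (Fin.castAdd l i)) (t fun i => w (Fin.natAdd k i))

theorem tensorMul_braid_left (q : Set.Ioo (0 : ℝ) 1) {k l : ℕ} {i j : Fin k} (hij : i ≠ j)
    (s : Word k → SUq q) (t : Word l → SUq q) :
    tensorMul q (braidAt q (SUq q) i j s) t =
      braidAt q (SUq q) (Fin.castAdd l i) (Fin.castAdd l j) (tensorMul q s t) := by
  funext w
  simp only [tensorMul, braidAt, LinearMap.coe_mk, AddHom.coe_mk, Finset.sum_mul, smul_mul_assoc]
  refine Finset.sum_congr rfl fun p _ => ?_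
  by_cases h0 : braid q p.1 p.2 (w (Fin.castAdd l i), w (Fin.castAdd l j)) = 0
  · rw [h0, Complex.ofReal_zero, zero_smul, zero_smul]
  have e1 : (fun x : Fin k => Function.update (Function.update w (Fin.castAdd l i) p.1)
      (Fin.castAdd l j) p.2 (Fin.castAdd l x)) =
      Function.update (Function.update (fun x => w (Fin.castAdd l x)) i p.1) j p.2 := by
    funext x
    simp only [Function.update_apply, (Fin.castAdd_injective k l).eq_iff]
  have e2 : (fun x : Fin l => Function.update (Function.update w (Fin.castAdd l i) p.1)
      (Fin.castAdd l j) p.2 (Fin.natAdd k x)) = fun x => w (Fin.natAdd k x) := by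
    funext x
    have : ∀ y : Fin k, Fin.natAdd k x ≠ Fin.castAdd l y := fun y h => by
      have := congrArg Fin.val h
      simp at this
      omega
    simp only [Function.update_apply, this, if_false]
  rw [e1, e2, weight_update_of_braid q _ hij h0]

theorem tensorMul_braid_right (q : Set.Ioo (0 : ℝ) 1) {k l : ℕ} (i j : Fin l)
    (s : Word k → SUq q) (t : Word l → SUq q) :
    tensorMul q s (braidAt q (SUq q) i j t) =
      braidAt q (SUq q) (Fin.natAdd k i) (Fin.natAdd k j) (tensorMul q s t) := by
  funext w
  simp only [tensorMul, braidAt, LinearMap.coe_mk, AddHom.coe_mk, map_sum, map_smul,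
    Finset.mul_sum, mul_smul_comm]
  refine Finset.sum_congr rfl fun p _ => ?_
  have e1 : (fun x : Fin l => Function.update (Function.update w (Fin.natAdd k i) p.1)
      (Fin.natAdd k j) p.2 (Fin.natAdd k x)) =
      Function.update (Function.update (fun x => w (Fin.natAdd k x)) i p.1) j p.2 := by
    funext x
    simp only [Function.update_apply, (Fin.natAdd_injective l k).eq_iff]
  have e2 : (fun x : Fin k => Function.update (Function.update w (Fin.natAdd k i) p.1)
      (Fin.natAdd k j) p.2 (Fin.castAdd l x)) = fun x => w (Fin.castAdd l x) := by
    funext x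
    have : ∀ y : Fin l, Fin.castAdd l x ≠ Fin.natAdd k y := fun y h => by
      have := congrArg Fin.val h
      simp at this
      omega
    simp only [Function.update_apply, this, if_false]
  rw [e1, e2]

theorem tensorMul_sub_left (q : Set.Ioo (0 : ℝ) 1) {k l : ℕ} (s s' : Word k → SUq q)
    (t : Word l → SUq q) : tensorMul q (s - s') t = tensorMul q s t - tensorMul q s' t := by
  funext w; simp [tensorMul, sub_mul]

theorem tensorMul_add_left (q : Set.Ioo (0 : ℝ) 1) {k l : ℕ} (s s' : Word k → SUq q)
    (t : Word l → SUq q) : tensorMul q (s + s') t = tensorMul q s t + tensorMul q s' t := by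
  funext w; simp [tensorMul, add_mul]

theorem tensorMul_sub_right (q : Set.Ioo (0 : ℝ) 1) {k l : ℕ} (s : Word k → SUq q)
    (t t' : Word l → SUq q) : tensorMul q s (t - t') = tensorMul q s t - tensorMul q s t' := by
  funext w; simp [tensorMul, mul_sub]

theorem tensorMul_add_right (q : Set.Ioo (0 : ℝ) 1) {k l : ℕ} (s : Word k → SUq q)
    (t t' : Word l → SUq q) : tensorMul q s (t + t') = tensorMul q s t + tensorMul q s t' := by
  funext w; simp [tensorMul, mul_add]

theorem asym_of_four_le (q : Set.Ioo (0 : ℝ) 1) {R : Type*} [Ring R] [Algebra ℂ R] {k : ℕ}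
    (hk : 4 ≤ k) (s : Word k → R) : asym q R k s = 0 := by
  obtain ⟨n, rfl⟩ := Nat.exists_eq_add_of_le' hk
  rfl

theorem asym_tensorMul_left (q : Set.Ioo (0 : ℝ) 1) (k l : ℕ) (s : Word k → SUq q)
    (t : Word l → SUq q) : asym q (SUq q) (k + l) (tensorMul q (asym q (SUq q) k s) t) =
      (lam q k : ℂ) • asym q (SUq q) (k + l) (tensorMul q s t) := by
  match k, l with
  | 0, _ => simp [asym, lam]
  | 1, _ => simp [asym, lam]
  | 2, 0 =>
    have h : tensorMul q (braidAt q (SUq q) 0 1 s) t = braidAt q (SUq q) 0 1 (tensorMul q s t) :=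
      tensorMul_braid_left q (i := (0 : Fin 2)) (j := 1) (by decide) s t
    generalize hu : tensorMul q s t = u at h ⊢
    rw [asym_two q s, tensorMul_sub_left, hu, h]
    exact asym_asym q 2 u
  | 2, 1 =>
    have h : tensorMul q (braidAt q (SUq q) 0 1 s) t =
        braidAt q (SUq q) (0 : Fin 3) 1 (tensorMul q s t) :=
      tensorMul_braid_left q (i := (0 : Fin 2)) (j := 1) (by decide) s t
    generalize hu : tensorMul q s t = u at h ⊢
    rw [asym_two q s, tensorMul_sub_left, hu, h]
    exact asym_three_sub_01 q u
  | 2, l + 2 => rw [asym_of_four_le q (by omega), asym_of_four_le q (by omega), smul_zero]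
  | 3, 0 =>
    have h01 : ∀ s : Word 3 → SUq q, tensorMul q (braidAt q (SUq q) 0 1 s) t =
        braidAt q (SUq q) (0 : Fin 3) 1 (tensorMul q s t) := fun s =>
      tensorMul_braid_left q (i := (0 : Fin 3)) (j := 1) (by decide) s t
    have h12 : ∀ s : Word 3 → SUq q, tensorMul q (braidAt q (SUq q) 1 2 s) t =
        braidAt q (SUq q) (1 : Fin 3) 2 (tensorMul q s t) := fun s =>
      tensorMul_braid_left q (i := (1 : Fin 3)) (j := 2) (by decide) s t
    have e : tensorMul q (asym q (SUq q) 3 s) t = asym q (SUq q) 3 (tensorMul q s t) := by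
      rw [asym_three, asym_three]
      simp only [tensorMul_sub_left, tensorMul_add_left, h01, h12]
    rw [e]
    exact asym_asym q 3 _
  | 3, l + 1 => rw [asym_of_four_le q (by omega), asym_of_four_le q (by omega), smul_zero]
  | k + 4, l => rw [asym_of_four_le q (by omega), asym_of_four_le q (by omega), smul_zero]

theorem asym_tensorMul_right (q : Set.Ioo (0 : ℝ) 1) (k l : ℕ) (s : Word k → SUq q)
    (t : Word l → SUq q) : asym q (SUq q) (k + l) (tensorMul q s (asym q (SUq q) l t)) =
      (lam q l : ℂ) • asym q (SUq q) (k + l) (tensorMul q s t) := by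
  match l, k with
  | 0, _ => simp [asym, lam]
  | 1, _ => simp [asym, lam]
  | 2, 0 =>
    have h : tensorMul q s (braidAt q (SUq q) 0 1 t) =
        braidAt q (SUq q) (0 : Fin 2) 1 (tensorMul q s t) :=
      tensorMul_braid_right q (0 : Fin 2) 1 s t
    generalize hu : tensorMul q s t = u at h ⊢
    rw [asym_two q t, tensorMul_sub_right, hu, h]
    exact asym_asym q 2 u
  | 2, 1 =>
    have h : tensorMul q s (braidAt q (SUq q) 0 1 t) =
        braidAt q (SUq q) (1 : Fin 3) 2 (tensorMul q s t) :=
      tensorMul_braid_right q (0 : Fin 2) 1 s t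
    generalize hu : tensorMul q s t = u at h ⊢
    rw [asym_two q t, tensorMul_sub_right, hu, h]
    exact asym_three_sub_12 q u
  | 2, l + 2 => rw [asym_of_four_le q (by omega), asym_of_four_le q (by omega), smul_zero]
  | 3, 0 =>
    have h01 : ∀ t : Word 3 → SUq q, tensorMul q s (braidAt q (SUq q) 0 1 t) =
        braidAt q (SUq q) (0 : Fin 3) 1 (tensorMul q s t) := fun t =>
      tensorMul_braid_right q (0 : Fin 3) 1 s t
    have h12 : ∀ t : Word 3 → SUq q, tensorMul q s (braidAt q (SUq q) 1 2 t) =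
        braidAt q (SUq q) (1 : Fin 3) 2 (tensorMul q s t) := fun t =>
      tensorMul_braid_right q (1 : Fin 3) 2 s t
    have e : tensorMul q s (asym q (SUq q) 3 t) = asym q (SUq q) 3 (tensorMul q s t) := by
      rw [asym_three, asym_three]
      simp only [tensorMul_sub_right, tensorMul_add_right, h01, h12]
    rw [e]
    exact asym_asym q 3 _
  | 3, l + 1 => rw [asym_of_four_le q (by omega), asym_of_four_le q (by omega), smul_zero]
  | k + 4, l => rw [asym_of_four_le q (by omega), asym_of_four_le q (by omega), smul_zero]

/-- The wedge product, that is `A⁽ᵏ⁾ s ∧ A⁽ˡ⁾ t = A⁽ᵏ⁺ˡ⁾ (s ⊗ t)`, see `wedge_asym`. -/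
def wedge (q : Set.Ioo (0 : ℝ) 1) {k l : ℕ} (φ : forms q k) (ψ : forms q l) : forms q (k + l) :=
  ⟨asym q (SUq q) (k + l) (((lam q k * lam q l : ℝ) : ℂ)⁻¹ • tensorMul q φ ψ), _, rfl⟩

theorem lam_pos (q : Set.Ioo (0 : ℝ) 1) (k : ℕ) : 0 < lam q k := by
  have := q.2.1
  unfold lam
  split <;> positivity

theorem wedge_asym (q : Set.Ioo (0 : ℝ) 1) {k l : ℕ} (s : Word k → SUq q) (t : Word l → SUq q) :
    wedge q ⟨asym q (SUq q) k s, s, rfl⟩ ⟨asym q (SUq q) l t, t, rfl⟩ =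
      ⟨asym q (SUq q) (k + l) (tensorMul q s t), _, rfl⟩ := by
  have h : ((lam q k * lam q l : ℝ) : ℂ) ≠ 0 :=
    Complex.ofReal_ne_zero.mpr (mul_pos (lam_pos q k) (lam_pos q l)).ne'
  refine Subtype.ext ?_
  change asym q (SUq q) (k + l) (_ • tensorMul q _ _) = _
  rw [asym_smul, asym_tensorMul_left, asym_tensorMul_right, smul_smul, smul_smul, mul_assoc,
    ← Complex.ofReal_mul, inv_mul_cancel₀ h, one_smul]

/-! Basic forms, volume and integral. -/

/-- The basis form `ω_a`, as a left-invariant form. -/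
def omegaInv (q : Set.Ioo (0 : ℝ) 1) (a : Idx) : invForms q 1 :=
  ⟨Pi.single ![a] 1, _, rfl⟩

/-- The basis form `ω_a`. -/
def omega (q : Set.Ioo (0 : ℝ) 1) (a : Idx) : forms q 1 := form q 1 (omegaInv q a)

/-- The function `1`, as a form of degree zero. -/
def oneForm (q : Set.Ioo (0 : ℝ) 1) : forms q 0 := ⟨fun _ => 1, _, rfl⟩

/-- The label of `ω_- ⊗ ω_+ ⊗ ω_z`. -/
def topWord : Word 3 := ![.minus, .plus, .zed]

/-- The left-invariant top form `θ = ω_- ∧ ω_+ ∧ ω_z`. -/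
def thetaInv (q : Set.Ioo (0 : ℝ) 1) : invForms q 3 :=
  ⟨asym q ℂ 3 (Pi.single topWord 1), _, rfl⟩

/-- The top form `θ = ω_- ∧ ω_+ ∧ ω_z`, see `theta_eq_wedge`. -/
def theta (q : Set.Ioo (0 : ℝ) 1) : forms q 3 := form q 1 (thetaInv q)

/-- The volume form `μ = m θ`. -/
def vol (q : Set.Ioo (0 : ℝ) 1) (m : ℝ) : forms q 3 := (m : ℂ) • theta q

/-- The integral `∫_μ x μ = h(x)` of a form of degree `n = 3`, see `integral_smul_vol`; the
coefficient of `ω_- ⊗ ω_+ ⊗ ω_z` in `θ` is `q ^ 4`. -/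
def integral (q : Set.Ioo (0 : ℝ) 1) (m : ℝ) {n : ℕ} (hn : n = 3) (η : forms q n) : ℂ :=
  haar q ((m * qC q ^ 4 : ℂ)⁻¹ • (η : Word n → SUq q) fun i => topWord (Fin.cast hn i))

theorem incl_single (q : Set.Ioo (0 : ℝ) 1) {k : ℕ} (w : Word k) :
    incl q (Pi.single w 1) = Pi.single w 1 := by
  funext v
  rcases eq_or_ne v w with rfl | h
  · simp [incl]
  · simp [incl, Pi.single_eq_of_ne h]

theorem tensorMul_single (q : Set.Ioo (0 : ℝ) 1) {k l : ℕ} (v : Word k) (w : Word l) :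
    tensorMul q (Pi.single v 1) (Pi.single w 1) = Pi.single (Fin.append v w) 1 := by
  funext u
  have hu : u = Fin.append v w ↔
      (fun i => u (Fin.castAdd l i)) = v ∧ (fun i => u (Fin.natAdd k i)) = w := by
    constructor
    · rintro rfl
      simp
    · rintro ⟨rfl, rfl⟩
      exact (Fin.append_castAdd_natAdd (f := u)).symm
  simp only [tensorMul, Pi.single_apply, hu]
  split_ifs <;> simp_all

theorem theta_eq_wedge (q : Set.Ioo (0 : ℝ) 1) : theta q =
    wedge q (k := 2) (wedge q (omega q .minus) (omega q .plus)) (omega q .zed) := by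
  have h1 : ∀ a, omega q a = ⟨asym q (SUq q) 1 (Pi.single ![a] 1), _, rfl⟩ := fun a =>
    Subtype.ext (by
      change (1 : SUq q) • incl q (Pi.single ![a] 1) = Pi.single ![a] 1
      rw [one_smul, incl_single])
  have h3 : theta q = ⟨asym q (SUq q) 3 (Pi.single topWord 1), _, rfl⟩ :=
    Subtype.ext (by
      change (1 : SUq q) • incl q (asym q ℂ 3 (Pi.single topWord 1)) = _
      rw [one_smul, incl_asym, incl_single])
  have e2 : tensorMul q (Pi.single ![Idx.minus] 1) (Pi.single ![Idx.plus] 1) =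
      (Pi.single ![.minus, .plus] 1 : Word 2 → SUq q) :=
    (tensorMul_single q _ _).trans
      (congrArg (fun w : Word 2 => (Pi.single w 1 : Word 2 → SUq q))
        (by funext i; fin_cases i <;> rfl))
  have e3 : tensorMul q (Pi.single ![Idx.minus, .plus] 1) (Pi.single ![Idx.zed] 1) =
      (Pi.single topWord 1 : Word 3 → SUq q) :=
    (tensorMul_single q _ _).trans
      (congrArg (fun w : Word 3 => (Pi.single w 1 : Word 3 → SUq q))
        (by funext i; fin_cases i <;> rfl))
  have h2 : wedge q (omega q .minus) (omega q .plus) =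
      (⟨asym q (SUq q) 2 (Pi.single ![.minus, .plus] 1), _, rfl⟩ : forms q 2) := by
    rw [h1, h1, wedge_asym]
    exact Subtype.ext (congrArg (asym q (SUq q) 2) e2)
  rw [h1 .zed, h2, h3]
  refine Eq.trans ?_ (wedge_asym q (k := 2) (l := 1) _ _).symm
  exact Subtype.ext (congrArg (asym q (SUq q) 3) e3.symm)

theorem theta_topWord (q : Set.Ioo (0 : ℝ) 1) :
    (theta q : Word 3 → SUq q) topWord = algebraMap ℂ (SUq q) (qC q ^ 4) := by
  change ((1 : SUq q) • incl q (asym q ℂ 3 (Pi.single topWord 1))) topWord = _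
  rw [one_smul]
  refine congrArg (algebraMap ℂ (SUq q)) (?_ : asym q ℂ 3 (Pi.single topWord 1) topWord = _)
  have h : ∀ a b c a' b' c' : Idx, (![a, b, c] = ![a', b', c']) ↔ (a = a' ∧ b = b' ∧ c = c') := by
    intros
    simp [funext_iff, Fin.forall_fin_succ]
  rw [asym_three]
  simp only [Pi.add_apply, Pi.sub_apply, topWord, braidAt_01, braidAt_12, braid_sum]
  simp [h]
  have hq : qC q ≠ 0 := Complex.ofReal_ne_zero.mpr q.2.1.ne'
  field_simp
  ring

theorem integral_smul_vol (q : Set.Ioo (0 : ℝ) 1) {m : ℝ} (hm : m ≠ 0) (x : SUq q) :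
    integral q m rfl (x • vol q m) = haar q x := by
  have hq : qC q ≠ 0 := Complex.ofReal_ne_zero.mpr q.2.1.ne'
  have hm' : (m : ℂ) ≠ 0 := Complex.ofReal_ne_zero.mpr hm
  have : (x • vol q m : forms q 3).1 topWord = (m * qC q ^ 4 : ℂ) • x := by
    change x * ((m : ℂ) • (theta q).1 topWord) = _
    rw [theta_topWord, mul_smul_comm, ← Algebra.commutes, ← Algebra.smul_def, mul_smul]
  change haar q (_ • (x • vol q m : forms q 3).1 topWord) = _
  rw [this, smul_smul, inv_mul_cancel₀ (mul_ne_zero hm' (pow_ne_zero 4 hq)), one_smul]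

/-! Contractions and the dual operator. -/

/-- The left-invariant contractions `g : Γ_inv × Γ_inv → ℂ`; vectors are coordinates with respect
to the basis `ω_a`. -/
abbrev Contraction : Type := LinearMap.BilinForm ℂ (Idx → ℂ)

/-- The right `U(1)`-coaction on `Γ_inv`, with values in `Γ_inv ⊗ ℂ[z, z⁻¹]`. -/
def coaction (v : Idx → ℂ) : Idx → LaurentPolynomial ℂ :=
  fun a => LaurentPolynomial.C (v a) * LaurentPolynomial.T a.degree

/-- Right `U(1)`-invariance of a contraction. -/
def RightInvariant (g : Contraction) : Prop :=
  ∀ v w : Idx → ℂ, ∑ a, ∑ b, LaurentPolynomial.C (g (Pi.single a 1) (Pi.single b 1)) *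
    (coaction v a * coaction w b) = LaurentPolynomial.C (g v w)

/-- The contraction with `g(ω_-, ω_+) = α`, `g(ω_+, ω_-) = β`, `g(ω_z, ω_z) = γ`, all other
coefficients being zero. -/
def contraction (α β γ : ℂ) : Contraction :=
  LinearMap.mk₂ ℂ
    (fun v w => α * v .minus * w .plus + β * v .plus * w .minus + γ * v .zed * w .zed)
    (fun _ _ _ => by simp only [Pi.add_apply]; ring)
    (fun _ _ _ => by simp only [Pi.smul_apply, smul_eq_mul]; ring)
    (fun _ _ _ => by simp only [Pi.add_apply]; ring)
    (fun _ _ _ => by simp only [Pi.smul_apply, smul_eq_mul]; ring)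

/-- The contraction of tensors, `(⊗ ω_(v j), ⊗ ω_(w j)) ↦ ∏ g(ω_(v j), ω_(w j))`. On
`Γ_inv^∧k = Range A⁽ᵏ⁾` it is the antisymmetrised extension of `g`, that is
`g(A⁽ᵏ⁾ s, A⁽ᵏ⁾ t) = ∑ (A⁽ᵏ⁾ s)_v (A⁽ᵏ⁾ t)_w ∏ g(ω_(v j), ω_(w j))`. -/
def contract (g : Contraction) {k : ℕ} (s t : Word k → ℂ) : ℂ :=
  ∑ v, ∑ w, s v * t w * ∏ j, g (Pi.single (v j) 1) (Pi.single (w j) 1)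

/-- The scalar product `⟨x ω, x' ω'⟩ = h(x* x') (1 / λ_k) g(ω*, ω')`. -/
def scal (q : Set.Ioo (0 : ℝ) 1) (g : Contraction) {k : ℕ} (x : SUq q) (ω : invForms q k)
    (x' : SUq q) (ω' : invForms q k) : ℂ :=
  haar q (star x * x') * ((1 / lam q k : ℝ) : ℂ) * contract g (starConst (ω : Word k → ℂ)) (ω' : Word k → ℂ)

/-- A family of `ℂ`-linear operators `T : Γ^∧k → Γ^∧(3-k)`; the target degree is `l` with
`k + l = 3`. -/
abbrev FormOperator (q : Set.Ioo (0 : ℝ) 1) : Type :=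
  ∀ k l : ℕ, k + l = 3 → (forms q k →ₗ[ℂ] forms q l)

/-- `T` is dual to the scalar product:
`⟨x ω, x' ω'⟩ = ∫_μ (x ω)* ∧ T(x' ω')` for left-invariant `ω, ω'` of the same degree. -/
def IsDual (q : Set.Ioo (0 : ℝ) 1) (g : Contraction) (m : ℝ) (T : FormOperator q) : Prop :=
  ∀ (k l : ℕ) (h : k + l = 3) (x x' : SUq q) (ω ω' : invForms q k),
    scal q g x ω x' ω' =
      integral q m h (wedge q (starForm q (form q x ω)) (T k l h (form q x' ω')))

/-- `T` is left `A(SU_q(2))`-linear. -/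
def IsLeftLinear (q : Set.Ioo (0 : ℝ) 1) (T : FormOperator q) : Prop :=
  ∀ (k l : ℕ) (h : k + l = 3) (x : SUq q) (φ : forms q k), T k l h (x • φ) = x • T k l h φ

/-- `T²` is a constant on 1-forms. -/
def IsSymm (q : Set.Ioo (0 : ℝ) 1) (T : FormOperator q) : Prop :=
  ∃ ζ : ℂ, ∀ φ : forms q 1, T 2 1 rfl (T 1 2 rfl φ) = ζ • φ

/-- `T` commutes with `*` on left-invariant 1-forms. -/
def IsReal (q : Set.Ioo (0 : ℝ) 1) (T : FormOperator q) : Prop :=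
  ∀ a : Idx, T 1 2 rfl (starForm q (omega q a)) = starForm q (T 1 2 rfl (omega q a))

/-- The set `𝔊_σ` of non degenerate, left-invariant and right `U(1)`-invariant contractions which
are symmetric and real, with respect to the volume form `m θ`. -/
def symmRealContractions (q : Set.Ioo (0 : ℝ) 1) (m : ℝ) : Set Contraction :=
  {g | RightInvariant g ∧ g.Nondegenerate ∧ ∃ T, IsDual q g m T ∧ IsSymm q T ∧ IsReal q T}

/-- The quantum determinant `det g = ⟨μ, μ⟩`. -/
def qdet (q : Set.Ioo (0 : ℝ) 1) (g : Contraction) (m : ℝ) : ℂ :=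
  scal q g 1 ((m : ℂ) • thetaInv q) 1 ((m : ℂ) • thetaInv q)

/-- The signature `sgn(g) = sgn(det g)`, for a real determinant. -/
def sgn (q : Set.Ioo (0 : ℝ) 1) (g : Contraction) (m : ℝ) : ℝ := Real.sign (qdet q g m).re

end QHodge

end

open QHodge

/-!
The Hodge operators on the three-dimensional calculus of `SU_q(2)` are found by writing the scalar
product and the integral in coordinates, where both turn out to be diagonal.

An antisymmetric tensor is an eigenvector of the braiding with eigenvalue `-q²` (`exchange_two`,
`exchange_01`, `exchange_12`), so its coefficients obey exchange rules and it is determined by one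
coefficient in degrees 0 and 3 and by three coefficients in degrees 1 and 2. A `Frame` records the
words at which these coefficients are read and the dual basis of left-invariant forms.

In such coordinates `g(ω*, ω')` is a diagonal sesquilinear form with entries `G_i` on the
left-invariant `k`-forms (`contract_zero` to `contract_three`), and `∫ φ* ∧ ψ` equals
`∑ P_i h(φ_i* ψ_i)` with non-zero `P_i` (`integral_zero_three` to `integral_three_zero`). For the
latter, coefficients have to be moved past forms, which twists them by the modular factors of the
right module structure; the Haar state is invariant under these twists (`haar_twist`), because
Woronowicz's representation intertwines the `U(1)`-coaction with a diagonal operator.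

The duality condition thus reads `h(x* (λ_k⁻¹ G_i φ_i - P_i (T φ)_i)) = 0` for all `x`, and as the
Haar state is faithful it says that `T` multiplies the `i`-th coefficient by `G_i / (λ_k P_i)`
(`Frame.isDualAt_iff`). This gives existence, uniqueness and left linearity of `T` and all of its
values; symmetry and reality become the equations `β = q⁶ α` and `β = q⁶ conj α`, `γ = conj γ`
(`hodge_entries_iff`, `isReal_iff`), and the normalisation of `T²(1)` an equation for `m²`.

Faithfulness of the Haar state (`haar_faithful`): `h(x* x)` is a series of squared lengths, so if it
vanishes then `x` annihilates all the vectors `e_(n,0)`. The Poincaré–Birkhoff–Witt monomials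
`a^i c^j c*^l` and `a*^i c^j c*^l` span the algebra (`span_pbw`), and a combination of them that
annihilates all `e_(n,0)` is zero, since its matrix coefficients are non-zero multiples of values of
polynomials at the infinitely many points `q ^ n` (`pbw_coeff_eq_zero`).
-/

noncomputable section

namespace QHodge

/-! ### The Haar state: invariance and faithfulness -/

/-- The diagonal operator `e_(n,k) ↦ t ^ (k - n) e_(n,k)`, which implements `rot q t` in
Woronowicz's representation. -/
def rotOp (t : ℂˣ) : Module.End ℂ Vec :=
  Finsupp.lsum ℂ fun p => ((t ^ (p.2 - p.1 : ℤ) : ℂˣ) : ℂ) • Finsupp.lsingle p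

theorem rotOp_single (t : ℂˣ) (p : ℕ × ℤ) (z : ℂ) :
    rotOp t (Finsupp.single p z) =
      Finsupp.single p (((t ^ (p.2 - p.1 : ℤ) : ℂˣ) : ℂ) * z) := by
  simp [rotOp]

theorem rotOp_apply (t : ℂˣ) (v : Vec) (p : ℕ × ℤ) :
    rotOp t v p = ((t ^ (p.2 - p.1 : ℤ) : ℂˣ) : ℂ) * v p := by
  classical
  induction v using Finsupp.induction_linear with
  | zero => simp
  | add u v hu hv => simp only [map_add, Finsupp.add_apply, hu, hv, mul_add]
  | single r z =>
    rw [rotOp_single, Finsupp.single_apply, Finsupp.single_apply]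
    split_ifs with h
    · rw [h]
    · rw [mul_zero]

theorem rep_gen (q : Set.Ioo (0 : ℝ) 1) (g : Gen) : rep q (gen q g) = repGen q g :=
  algLift_gen q _ _ g

/-- The automorphism `rot q t` is implemented by `rotOp t`; as `rotOp t` is diagonal, it does not
change the diagonal matrix coefficients that enter the Haar state. -/
theorem rep_rot (q : Set.Ioo (0 : ℝ) 1) (t : ℂˣ) (x : SUq q) :
    rep q (rot q t x) * rotOp t = rotOp t * rep q x := by
  induction x using algInduction with
  | scalar z => simp only [AlgHom.commutes]; exact Algebra.commutes _ _
  | mul x y hx hy => rw [map_mul, map_mul, map_mul, mul_assoc, hy, ← mul_assoc, hx, mul_assoc]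
  | add x y hx hy => simp only [map_add, add_mul, mul_add, hx, hy]
  | generator g =>
    rw [rot, algLift_gen, rep_gen]
    have ht : (t : ℂ) ≠ 0 := t.ne_zero
    ext ⟨n, k⟩ : 2
    cases g <;>
      simp only [map_smul, rep_gen, repGen, LinearMap.comp_apply, Module.End.mul_apply,
        Finsupp.lsingle_apply, rotOp_single, LinearMap.smul_apply, shift_single,
        Finsupp.smul_single, smul_eq_mul, mul_one, Units.val_zpow_eq_zpow_val,
        Units.val_inv_eq_inv_val]
    · cases n with
      | zero => simp
      | succ n =>
        congr 1
        rw [Nat.add_sub_cancel,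
          show (k - ((n : ℕ) : ℤ)) = (k - ((n + 1 : ℕ) : ℤ)) + 1 by push_cast; ring,
          zpow_add_one₀ ht]
        ring
    · congr 1
      rw [show (k - ((n + 1 : ℕ) : ℤ)) = (k - (n : ℤ)) - 1 by push_cast; ring, zpow_sub_one₀ ht]
      ring
    · congr 1
      rw [show (k + 1 - (n : ℤ)) = (k - (n : ℤ)) + 1 by ring, zpow_add_one₀ ht]
      ring
    · congr 1
      rw [show (k - 1 - (n : ℤ)) = (k - (n : ℤ)) - 1 by ring, zpow_sub_one₀ ht]
      ring

/-- The Haar state is invariant under the right `U(1)`-coaction. -/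
theorem haar_rot (q : Set.Ioo (0 : ℝ) 1) (t : ℂˣ) (x : SUq q) :
    haar q (rot q t x) = haar q x := by
  have h : haarTerm q (rot q t x) = haarTerm q x := by
    funext n
    have h1 := congrArg (fun L : Module.End ℂ Vec => L (Finsupp.single (n, 0) 1) (n, 0))
      (rep_rot q t x)
    simp only [Module.End.mul_apply, rotOp_single, rotOp_apply, mul_one] at h1
    rw [← mul_one ((t ^ _ : ℂˣ) : ℂ), ← smul_eq_mul, ← Finsupp.smul_single, map_smul,
      Finsupp.smul_apply, smul_eq_mul] at h1
    rw [smul_eq_mul, mul_one] at h1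
    rw [haarTerm, haarTerm, mul_left_cancel₀ (Units.ne_zero _) h1]
  change _ * ∑' n, haarTerm q (rot q t x) n = _ * ∑' n, haarTerm q x n
  rw [h]

theorem haar_twist (q : Set.Ioo (0 : ℝ) 1) (k : ℕ) (x : SUq q) :
    haar q (twist q k x) = haar q x :=
  haar_rot q _ x

/-- The scalar product of finite vectors, conjugate-linear in the first variable. -/
def ip (u : Vec) : Vec →ₗ[ℂ] ℂ := Finsupp.linearCombination ℂ fun p => starRingEnd ℂ (u p)

theorem ip_single (u : Vec) (p : ℕ × ℤ) (z : ℂ) :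
    ip u (Finsupp.single p z) = z * starRingEnd ℂ (u p) := by
  simp [ip]

theorem ip_add_left (u u' v : Vec) : ip (u + u') v = ip u v + ip u' v := by
  simp only [ip, Finsupp.linearCombination_apply, Finsupp.add_apply, map_add, smul_add,
    Finsupp.sum_add]

theorem ip_smul_left (t : ℂ) (u v : Vec) : ip (t • u) v = starRingEnd ℂ t * ip u v := by
  simp only [ip, Finsupp.linearCombination_apply, Finsupp.smul_apply, smul_eq_mul, map_mul,
    Finsupp.mul_sum]
  exact Finsupp.sum_congr fun p _ => by ring

theorem ip_single_left (p : ℕ × ℤ) (v : Vec) : ip (Finsupp.single p 1) v = v p := by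
  classical
  induction v using Finsupp.induction_linear with
  | zero => simp
  | add u v hu hv => simp only [map_add, Finsupp.add_apply, hu, hv]
  | single r z =>
    rw [ip_single, Finsupp.single_apply, Finsupp.single_apply]
    by_cases h : r = p
    · simp [h]
    · simp [h, Ne.symm h]

theorem ip_self (v : Vec) : ip v v = ((∑ p ∈ v.support, ‖v p‖ ^ 2 : ℝ) : ℂ) := by
  rw [ip, Finsupp.linearCombination_apply, Finsupp.sum, Complex.ofReal_sum]
  refine Finset.sum_congr rfl fun p _ => ?_
  rw [smul_eq_mul, Complex.mul_conj, Complex.normSq_eq_norm_sq]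

/-- Woronowicz's representation is a `*`-representation. -/
theorem ip_rep_star (q : Set.Ioo (0 : ℝ) 1) (x : SUq q) (u v : Vec) :
    ip u (rep q (star x) v) = ip (rep q x u) v := by
  classical
  induction x using algInduction generalizing u v with
  | scalar t =>
    rw [star_scalar, AlgHom.commutes, AlgHom.commutes, Module.algebraMap_end_apply,
      Module.algebraMap_end_apply, map_smul, ip_smul_left, smul_eq_mul]
  | mul x y hx hy =>
    rw [star_mul, map_mul, map_mul, Module.End.mul_apply, Module.End.mul_apply, hy, hx]
  | add x y hx hy =>
    rw [star_add, map_add, map_add, LinearMap.add_apply, LinearMap.add_apply, map_add,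
      ip_add_left, hx, hy]
  | generator g =>
    rw [star_gen, rep_gen, rep_gen]
    induction u using Finsupp.induction_linear with
    | zero => simp [ip, Finsupp.linearCombination_apply]
    | add u u' hu hu' => rw [ip_add_left, map_add, ip_add_left, hu, hu']
    | single p s =>
      induction v using Finsupp.induction_linear with
      | zero => simp
      | add v v' hv hv' => rw [map_add, map_add, map_add, hv, hv']
      | single r t =>
        obtain ⟨n, k⟩ := p
        obtain ⟨n', k'⟩ := r
        cases g <;>
          simp only [Gen.bar, repGen, shift_single, ip_single, Finsupp.single_apply, Prod.mk.injEq]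
        · cases n with
          | zero => simp
          | succ n =>
            simp only [Nat.add_sub_cancel, Nat.add_right_cancel_iff]
            split_ifs with h
            · simp [h.1]; ring
            · simp
        · cases n' with
          | zero => simp
          | succ n' =>
            simp only [Nat.add_sub_cancel, Nat.add_right_cancel_iff]
            split_ifs with h
            · simp [h.1]; ring
            · simp
        · have : (n = n' ∧ k = k' - 1) ↔ (n = n' ∧ k + 1 = k') := by omega
          simp only [this]
          split_ifs with h
          · simp [h.1]; ring
          · simp
        · have : (n = n' ∧ k = k' + 1) ↔ (n = n' ∧ k - 1 = k') := by omega
          simp only [this]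
          split_ifs with h
          · simp [h.1]; ring
          · simp

theorem haarTerm_star_mul (q : Set.Ioo (0 : ℝ) 1) (x : SUq q) (n : ℕ) :
    haarTerm q (star x * x) n = (((q : ℝ) ^ (2 * n) *
      ∑ p ∈ (rep q x (Finsupp.single (n, 0) 1)).support,
        ‖rep q x (Finsupp.single (n, 0) 1) p‖ ^ 2 : ℝ) : ℂ) := by
  rw [haarTerm, map_mul, Module.End.mul_apply, ← ip_single_left, ip_rep_star, ip_self, qC]
  push_cast
  rfl

/-- A vector `x` of length zero for the Haar state annihilates every `e_(n,0)`. -/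
theorem rep_eq_zero_of_haar (q : Set.Ioo (0 : ℝ) 1) (x : SUq q) (hx : haar q (star x * x) = 0)
    (n : ℕ) : rep q x (Finsupp.single (n, 0) 1) = 0 := by
  have hq2 : (q : ℝ) ^ 2 < 1 := pow_lt_one₀ q.2.1.le q.2.2 two_ne_zero
  have h1 : (1 : ℂ) - qC q ^ 2 ≠ 0 := fun e => by
    have e' : (1 : ℂ) = (((q : ℝ) ^ 2 : ℝ) : ℂ) := by
      rw [sub_eq_zero.mp e, qC, Complex.ofReal_pow]
    rw [← Complex.ofReal_one, Complex.ofReal_inj] at e'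
    linarith
  have h2 : ∑' n, haarTerm q (star x * x) n = 0 := (mul_eq_zero.mp hx).resolve_left h1
  have hs := haarTerm_summable q (star x * x)
  have e := funext (haarTerm_star_mul q x)
  rw [e] at h2 hs
  rw [← Complex.ofReal_tsum, Complex.ofReal_eq_zero] at h2
  have hs' := Complex.summable_ofReal.mp hs
  have h0 : ∀ v : Vec, 0 ≤ ∑ p ∈ v.support, ‖v p‖ ^ 2 := fun v =>
    Finset.sum_nonneg fun _ _ => sq_nonneg _
  have h3 := (hasSum_zero_iff_of_nonneg
    (fun n => mul_nonneg (pow_nonneg q.2.1.le _) (h0 _))).mp (h2 ▸ hs'.hasSum)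
  have h4 := (mul_eq_zero.mp (congrFun h3 n)).resolve_left (pow_ne_zero _ q.2.1.ne')
  ext p
  by_contra hp
  have h5 := (Finset.sum_eq_zero_iff_of_nonneg (fun _ _ => sq_nonneg _)).mp h4 p
    (Finsupp.mem_support_iff.mpr hp)
  exact hp (by simpa using h5)

/-! ### The Poincaré–Birkhoff–Witt basis -/

/-- The powers of `a` (for `i ≥ 0`) and of `a*` (for `i < 0`). -/
def aPow (q : Set.Ioo (0 : ℝ) 1) : ℤ → SUq q
  | Int.ofNat n => gen q .a ^ n
  | Int.negSucc n => gen q .aStar ^ (n + 1)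

/-- The Poincaré–Birkhoff–Witt monomials `a ^ i c ^ j c* ^ l`, with `a ^ i` read as
`(a*) ^ (-i)` for `i < 0`. -/
def pbw (q : Set.Ioo (0 : ℝ) 1) (p : ℤ × ℕ × ℕ) : SUq q :=
  aPow q p.1 * (gen q .c ^ p.2.1 * gen q .cStar ^ p.2.2)

theorem mul_pow_of_skew {A : Type*} [Ring A] [Algebra ℂ A] {x y : A} {t : ℂ}
    (h : y * x = t • (x * y)) (n : ℕ) : y * x ^ n = t ^ n • (x ^ n * y) := by
  induction n with
  | zero => simp
  | succ n ih =>
    rw [pow_succ, ← mul_assoc, ih, smul_mul_assoc, mul_assoc, h, mul_smul_comm, smul_smul,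
      pow_succ, mul_assoc]

theorem qC_ne_zero (q : Set.Ioo (0 : ℝ) 1) : qC q ≠ 0 :=
  Complex.ofReal_ne_zero.mpr q.2.1.ne'

theorem c_mul_aPow (q : Set.Ioo (0 : ℝ) 1) (i : ℤ) :
    ∃ t : ℂ, gen q .c * aPow q i = t • (aPow q i * gen q .c) := by
  have h := gen_relations q
  cases i with
  | ofNat n =>
    refine ⟨_, mul_pow_of_skew (t := (qC q)⁻¹) ?_ n⟩
    rw [h.ac, smul_smul, inv_mul_cancel₀ (qC_ne_zero q), one_smul]
  | negSucc n => exact ⟨_, mul_pow_of_skew h.cas (n + 1)⟩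

theorem cStar_mul_aPow (q : Set.Ioo (0 : ℝ) 1) (i : ℤ) :
    ∃ t : ℂ, gen q .cStar * aPow q i = t • (aPow q i * gen q .cStar) := by
  have h := gen_relations q
  cases i with
  | ofNat n =>
    refine ⟨_, mul_pow_of_skew (t := (qC q)⁻¹) ?_ n⟩
    rw [h.acs, smul_smul, inv_mul_cancel₀ (qC_ne_zero q), one_smul]
  | negSucc n => exact ⟨_, mul_pow_of_skew h.csas (n + 1)⟩

theorem a_mul_aPow (q : Set.Ioo (0 : ℝ) 1) (i : ℤ) : ∃ s : ℂ, gen q .a * aPow q i =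
    aPow q (i + 1) - s • (gen q .cStar * (gen q .c * aPow q (i + 1))) := by
  have h := gen_relations q
  rcases i with n | n
  · refine ⟨0, ?_⟩
    rw [zero_smul, sub_zero]
    exact (pow_succ' _ _).symm
  · have e : aPow q (Int.negSucc n + 1) = gen q .aStar ^ n := by
      rw [Int.negSucc_eq, neg_add, neg_add_cancel_right]
      cases n with
      | zero => simp [aPow]
      | succ n => rfl
    refine ⟨qC q ^ 2, ?_⟩
    rw [e, ← mul_assoc (gen q .cStar), ← smul_mul_assoc, ← one_sub_mul, ← h.aas,
      add_sub_cancel_right, mul_assoc, ← pow_succ']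
    rfl

theorem aStar_mul_aPow (q : Set.Ioo (0 : ℝ) 1) (i : ℤ) : ∃ s : ℂ, gen q .aStar * aPow q i =
    aPow q (i - 1) - s • (gen q .cStar * (gen q .c * aPow q (i - 1))) := by
  have h := gen_relations q
  rcases i with (_ | n) | n
  · refine ⟨0, ?_⟩
    rw [zero_smul, sub_zero]
    change _ * _ ^ 0 = _ ^ (0 + 1)
    simp
  · have e : aPow q (Int.ofNat (n + 1) - 1) = gen q .a ^ n := by
      rw [show Int.ofNat (n + 1) - 1 = Int.ofNat n by simp]
      rfl
    refine ⟨1, ?_⟩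
    rw [e, one_smul, ← mul_assoc (gen q .cStar), ← one_sub_mul, ← h.asa,
      add_sub_cancel_right, mul_assoc, ← pow_succ']
    rfl
  · refine ⟨0, ?_⟩
    rw [zero_smul, sub_zero, show Int.negSucc n - 1 = Int.negSucc (n + 1) from rfl]
    exact (pow_succ' _ _).symm

/-- The span of the PBW monomials is a left ideal. For `c` and `c*` this is skew commutation with
the powers of `a` and `a*`; for `a` and `a*` the products `a a*` and `a* a` bring in `c* c`, which
is already taken care of. -/
theorem mul_mem_span_pbw (q : Set.Ioo (0 : ℝ) 1) (x y : SUq q)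
    (hy : y ∈ Submodule.span ℂ (Set.range (pbw q))) :
    x * y ∈ Submodule.span ℂ (Set.range (pbw q)) := by
  have ext : ∀ x : SUq q, (∀ p, x * pbw q p ∈ Submodule.span ℂ (Set.range (pbw q))) →
      ∀ y ∈ Submodule.span ℂ (Set.range (pbw q)),
        x * y ∈ Submodule.span ℂ (Set.range (pbw q)) := fun x hx y hy => by
    induction hy using Submodule.span_induction with
    | mem y hy => obtain ⟨p, rfl⟩ := hy; exact hx p
    | zero => rw [mul_zero]; exact zero_mem _
    | add y z _ _ hy hz => rw [mul_add]; exact add_mem hy hz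
    | smul t y _ hy => rw [mul_smul_comm]; exact Submodule.smul_mem _ t hy
  have base : ∀ p, pbw q p ∈ Submodule.span ℂ (Set.range (pbw q)) := fun p =>
    Submodule.subset_span ⟨p, rfl⟩
  have h := gen_relations q
  have hc := ext (gen q .c) fun ⟨i, j, l⟩ => by
    obtain ⟨t, ht⟩ := c_mul_aPow q i
    have : gen q .c * pbw q (i, j, l) = t • pbw q (i, j + 1, l) := by
      simp only [pbw]
      rw [← mul_assoc, ht, smul_mul_assoc, pow_succ', mul_assoc, mul_assoc]
    rw [this]
    exact Submodule.smul_mem _ _ (base _)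
  have hcs := ext (gen q .cStar) fun ⟨i, j, l⟩ => by
    obtain ⟨t, ht⟩ := cStar_mul_aPow q i
    have hcomm : Commute (gen q .cStar) (gen q .c ^ j) := Commute.pow_right h.ccs.symm j
    have : gen q .cStar * pbw q (i, j, l) = t • pbw q (i, j, l + 1) := by
      simp only [pbw]
      rw [← mul_assoc, ht, smul_mul_assoc, mul_assoc, ← mul_assoc (gen q .cStar), hcomm.eq,
        mul_assoc, ← pow_succ']
    rw [this]
    exact Submodule.smul_mem _ _ (base _)
  induction x using algInduction generalizing y with
  | scalar t => rw [← Algebra.smul_def]; exact Submodule.smul_mem _ t hy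
  | mul x z hx hz => rw [mul_assoc]; exact hx _ (hz _ hy)
  | add x z hx hz => rw [add_mul]; exact add_mem (hx _ hy) (hz _ hy)
  | generator g =>
    cases g
    · refine ext _ (fun ⟨i, j, l⟩ => ?_) y hy
      obtain ⟨s, hs⟩ := a_mul_aPow q i
      have : gen q .a * pbw q (i, j, l) = pbw q (i + 1, j, l) -
          s • (gen q .cStar * (gen q .c * pbw q (i + 1, j, l))) := by
        simp only [pbw]
        rw [← mul_assoc, hs, sub_mul, smul_mul_assoc, mul_assoc, mul_assoc]
      rw [this]
      exact sub_mem (base _) (Submodule.smul_mem _ _ (hcs _ (hc _ (base _))))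
    · refine ext _ (fun ⟨i, j, l⟩ => ?_) y hy
      obtain ⟨s, hs⟩ := aStar_mul_aPow q i
      have : gen q .aStar * pbw q (i, j, l) = pbw q (i - 1, j, l) -
          s • (gen q .cStar * (gen q .c * pbw q (i - 1, j, l))) := by
        simp only [pbw]
        rw [← mul_assoc, hs, sub_mul, smul_mul_assoc, mul_assoc, mul_assoc]
      rw [this]
      exact sub_mem (base _) (Submodule.smul_mem _ _ (hcs _ (hc _ (base _))))
    · exact hc y hy
    · exact hcs y hy

theorem span_pbw (q : Set.Ioo (0 : ℝ) 1) : Submodule.span ℂ (Set.range (pbw q)) = ⊤ := by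
  refine eq_top_iff.mpr fun x _ => ?_
  rw [← mul_one x]
  refine mul_mem_span_pbw q x 1 (Submodule.subset_span ⟨(0, 0, 0), ?_⟩)
  change gen q .a ^ 0 * (_ ^ 0 * _ ^ 0) = 1
  simp

/-- The powers of `a` and `a*` are weighted shifts, and the weight at `e_(n,k)` is zero only if the
shift would lead below `n = 0`. -/
theorem rep_aPow (q : Set.Ioo (0 : ℝ) 1) (i : ℤ) (n : ℕ) :
    ∃ r : ℂ, (i ≤ n → r ≠ 0) ∧ ((n : ℤ) < i → r = 0) ∧ ∀ (k : ℤ) (z : ℂ),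
      rep q (aPow q i) (Finsupp.single (n, k) z) =
        Finsupp.single (((n : ℤ) - i).toNat, k) (r * z) := by
  have hpos : ∀ m : ℕ, ((√(1 - (q : ℝ) ^ (2 * (m + 1))) : ℝ) : ℂ) ≠ 0 := fun m => by
    have : (q : ℝ) ^ (2 * (m + 1)) < 1 := pow_lt_one₀ q.2.1.le q.2.2 (by omega)
    exact Complex.ofReal_ne_zero.mpr (Real.sqrt_pos.mpr (by linarith)).ne'
  rcases i with m | m
  · change ∃ r : ℂ, (_ → r ≠ 0) ∧ (_ → r = 0) ∧ ∀ (k : ℤ) (z : ℂ),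
      rep q (gen q .a ^ m) _ = _
    induction m with
    | zero => exact ⟨1, by simp, fun h => absurd h (by simp), fun k z => by simp⟩
    | succ m ih =>
      obtain ⟨r, h1, h2, h3⟩ := ih
      refine ⟨((√(1 - (q : ℝ) ^ (2 * (n - m))) : ℝ) : ℂ) * r, fun h => ?_, fun h => ?_,
        fun k z => ?_⟩
      · have h' : m + 1 ≤ n := by simpa using h
        refine mul_ne_zero ?_ (h1 (by simp; omega))
        rw [show n - m = (n - m - 1) + 1 by omega]
        exact hpos _
      · have h' : n < m + 1 := by simpa using h
        rw [show n - m = 0 by omega]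
        simp
      · rw [pow_succ', map_mul, Module.End.mul_apply, h3, rep_gen, repGen, shift_single]
        have e : ((n : ℤ) - Int.ofNat m).toNat = n - m := by simp
        have e' : ((n : ℤ) - Int.ofNat (m + 1)).toNat = n - m - 1 := by simp; omega
        rw [e, e', mul_assoc]
  · change ∃ r : ℂ, (_ → r ≠ 0) ∧ (_ → r = 0) ∧ ∀ (k : ℤ) (z : ℂ),
      rep q (gen q .aStar ^ (m + 1)) _ = _
    have key : ∀ m : ℕ, ∃ r : ℂ, r ≠ 0 ∧ ∀ (k : ℤ) (z : ℂ), rep q (gen q .aStar ^ m)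
        (Finsupp.single (n, k) z) = Finsupp.single (n + m, k) (r * z) := fun m => by
      induction m with
      | zero => exact ⟨1, one_ne_zero, fun k z => by simp⟩
      | succ m ih =>
        obtain ⟨r, h1, h3⟩ := ih
        refine ⟨_, mul_ne_zero (hpos (n + m)) h1, fun k z => ?_⟩
        rw [pow_succ', map_mul, Module.End.mul_apply, h3, rep_gen, repGen, shift_single, mul_assoc]
        rfl
    obtain ⟨r, h1, h3⟩ := key (m + 1)
    refine ⟨r, fun _ => h1, fun h => absurd h (by omega), fun k z => ?_⟩
    rw [h3, show ((n : ℤ) - Int.negSucc m).toNat = n + (m + 1) by omega]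

theorem rep_c_pow (q : Set.Ioo (0 : ℝ) 1) (j : ℕ) (n : ℕ) (k : ℤ) (z : ℂ) :
    rep q (gen q .c ^ j) (Finsupp.single (n, k) z) =
      Finsupp.single (n, k + j) ((qC q ^ n) ^ j * z) := by
  induction j with
  | zero => simp
  | succ j ih =>
    rw [pow_succ', map_mul, Module.End.mul_apply, ih, rep_gen, repGen, shift_single]
    refine congrArg₂ Finsupp.single (Prod.ext rfl (by push_cast; ring)) ?_
    rw [qC]; push_cast; ring

theorem rep_cStar_pow (q : Set.Ioo (0 : ℝ) 1) (j : ℕ) (n : ℕ) (k : ℤ) (z : ℂ) :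
    rep q (gen q .cStar ^ j) (Finsupp.single (n, k) z) =
      Finsupp.single (n, k - j) ((qC q ^ n) ^ j * z) := by
  induction j with
  | zero => simp
  | succ j ih =>
    rw [pow_succ', map_mul, Module.End.mul_apply, ih, rep_gen, repGen, shift_single]
    refine congrArg₂ Finsupp.single (Prod.ext rfl (by push_cast; ring)) ?_
    rw [qC]; push_cast; ring

/-- The PBW monomials are linearly independent already on the vectors `e_(n,0)`: a matrix
coefficient of a combination at `(n - i, j - l)` is, up to a non-zero factor, a polynomial in
`q ^ n`, so all its coefficients vanish if it is zero for all `n`. -/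
theorem pbw_coeff_eq_zero (q : Set.Ioo (0 : ℝ) 1) (f : (ℤ × ℕ × ℕ) →₀ ℂ)
    (hf : ∀ n : ℕ, rep q (f.sum fun p t => t • pbw q p) (Finsupp.single (n, 0) 1) = 0) :
    f = 0 := by
  classical
  ext ⟨i₀, j₀, l₀⟩
  -- `j - l` and `j + l` determine `(j, l)`, so `P` has the single coefficient `f (i₀, j₀, l₀)` in
  -- degree `j₀ + l₀`.
  let P : Polynomial ℂ := ∑ p ∈ f.support, if p.1 = i₀ ∧ (p.2.1 : ℤ) - p.2.2 = j₀ - l₀ then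
    Polynomial.monomial (p.2.1 + p.2.2) (f p) else 0
  have hroot : ∀ n : ℕ, P.IsRoot (qC q ^ (n + i₀.toNat)) := fun n' => by
    set n := n' + i₀.toNat with hn
    choose r hr1 hr2 hr3 using fun i => rep_aPow q i n
    refine (mul_eq_zero.mp ?_).resolve_left (hr1 i₀ (by omega))
    have h := DFunLike.congr_fun (hf n) (((n : ℤ) - i₀).toNat, (j₀ : ℤ) - l₀)
    rw [Finsupp.sum, map_sum, LinearMap.sum_apply, Finsupp.finsetSum_apply] at h
    refine Eq.trans ?_ h
    rw [Polynomial.eval_finsetSum, Finset.mul_sum]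
    refine Finset.sum_congr rfl fun ⟨i, j, l⟩ _ => ?_
    rw [map_smul, LinearMap.smul_apply, Finsupp.smul_apply, pbw, map_mul, map_mul,
      Module.End.mul_apply, Module.End.mul_apply, rep_cStar_pow, rep_c_pow, hr3,
      Finsupp.single_apply]
    simp only [Prod.mk.injEq]
    by_cases hi : (n : ℤ) < i
    · have hne : i ≠ i₀ := by omega
      simp [hr2 i hi, hne]
    · have hiff : (((n : ℤ) - i).toNat = ((n : ℤ) - i₀).toNat ∧ 0 - (l : ℤ) + j = j₀ - l₀) ↔
          (i = i₀ ∧ (j : ℤ) - l = j₀ - l₀) := by omega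
      simp only [hiff]
      split_ifs with hc
      · rw [Polynomial.eval_monomial, hc.1, smul_eq_mul]
        ring
      · simp
  have hP : P = 0 := by
    refine Polynomial.eq_zero_of_infinite_isRoot P
      ((Set.infinite_range_of_injective (f := fun n : ℕ => qC q ^ (n + i₀.toNat)) ?_).mono ?_)
    · intro m n h
      have h' : (q : ℝ) ^ (m + i₀.toNat) = (q : ℝ) ^ (n + i₀.toNat) := by
        simp only [qC] at h
        exact_mod_cast h
      exact Nat.add_right_cancel (pow_right_injective₀ q.2.1 q.2.2.ne h')
    · rintro _ ⟨n, rfl⟩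
      exact hroot n
  have hc := congrArg (fun Q : Polynomial ℂ => Q.coeff (j₀ + l₀)) hP
  simp only [P, Polynomial.finsetSum_coeff, Polynomial.coeff_zero] at hc
  rw [Finset.sum_eq_single (i₀, j₀, l₀)] at hc
  · simpa using hc
  · rintro ⟨i, j, l⟩ - hne
    split_ifs with h
    · rw [Polynomial.coeff_monomial, if_neg]
      intro h'
      simp only at h h'
      exact hne (by rw [Prod.mk.injEq, Prod.mk.injEq]; omega)
    · simp
  · intro h
    simp [Finsupp.notMem_support_iff.mp h]

/-- The Haar state is faithful. -/
theorem haar_faithful (q : Set.Ioo (0 : ℝ) 1) (x : SUq q) (hx : haar q (star x * x) = 0) :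
    x = 0 := by
  obtain ⟨f, rfl⟩ := Finsupp.mem_span_range_iff_exists_finsupp.mp
    ((span_pbw q).symm ▸ Submodule.mem_top : x ∈ Submodule.span ℂ (Set.range (pbw q)))
  rw [pbw_coeff_eq_zero q f (rep_eq_zero_of_haar q _ hx)]
  simp

/-- An element of the algebra is determined by its products against the Haar state. -/
theorem eq_of_haar_star_mul (q : Set.Ioo (0 : ℝ) 1) {y z : SUq q}
    (h : ∀ x, haar q (star x * y) = haar q (star x * z)) : y = z :=
  sub_eq_zero.mp (haar_faithful q _ (by rw [mul_sub, map_sub, h, sub_self]))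

/-! ### Coordinates of antisymmetric tensors -/

theorem one_add_qC_sq_ne_zero (q : Set.Ioo (0 : ℝ) 1) : (1 : ℂ) + qC q ^ 2 ≠ 0 := by
  rw [qC, ← Complex.ofReal_pow, ← Complex.ofReal_one, ← Complex.ofReal_add]
  exact Complex.ofReal_ne_zero.mpr (by positivity)

/-- A family on pairs of labels on which the braiding acts by the scalar `-q²` vanishes on the
diagonal and is determined by its values at `(-,+)`, `(-,z)` and `(+,z)`. -/
theorem exchange_of_braid (q : Set.Ioo (0 : ℝ) 1) {M : Type*} [AddCommGroup M] [Module ℂ M]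
    (F : Idx × Idx → M)
    (hF : ∀ p, ∑ r : Idx × Idx, (braid q r.1 r.2 p : ℂ) • F r = -(qC q ^ 2 • F p)) :
    (∀ a, F (a, a) = 0) ∧ F (.plus, .minus) = (-(qC q ^ 4)⁻¹) • F (.minus, .plus) ∧
      F (.zed, .minus) = (-(qC q ^ 6)⁻¹) • F (.minus, .zed) ∧
      F (.zed, .plus) = (-qC q ^ 6) • F (.plus, .zed) := by
  have hq := qC_ne_zero q
  have h2 : qC q ^ 2 ≠ 0 := pow_ne_zero 2 hq
  have inj : ∀ x y : M, qC q ^ 2 • x = qC q ^ 2 • y → x = y := fun x y h =>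
    smul_right_injective M h2 h
  simp only [braid_sum] at hF
  refine ⟨fun a => ?_, ?_, ?_, ?_⟩
  · have h : (1 + qC q ^ 2) • F (a, a) = 0 := by
      have := hF (a, a)
      rw [add_smul, one_smul, ← eq_neg_iff_add_eq_zero]
      cases a <;> exact this
    exact (smul_eq_zero.mp h).resolve_left (one_add_qC_sq_ne_zero q)
  · have h := hF (.plus, .minus)
    simp only at h
    refine inj _ _ ?_
    rw [← neg_inj, ← h]
    match_scalars
    field_simp
  · have h := hF (.zed, .minus)
    simp only at h
    refine inj _ _ ?_
    rw [← neg_inj, ← h]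
    match_scalars
    field_simp
  · have h := hF (.plus, .zed)
    simp only at h
    have e : F (.zed, .plus) = qC q ^ 4 • ((qC q ^ 4)⁻¹ • F (.zed, .plus)) := by
      rw [smul_smul, mul_inv_cancel₀ (pow_ne_zero 4 hq), one_smul]
    rw [e, h]
    match_scalars
    ring

section
variable (q : Set.Ioo (0 : ℝ) 1) {R : Type*} [Ring R] [Algebra ℂ R]

theorem braidAt_asym_two (s : Word 2 → R) :
    braidAt q R 0 1 (asym q R 2 s) = -(qC q ^ 2 • asym q R 2 s) := by
  simp only [asym_two, map_sub, hecke_two]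
  module

theorem braidAt_12_asym_three (s : Word 3 → R) :
    braidAt q R 1 2 (asym q R 3 s) = -(qC q ^ 2 • asym q R 3 s) := by
  simp only [asym_three, hecke_12, map_add, map_sub]
  module

theorem braidAt_01_asym_three (s : Word 3 → R) :
    braidAt q R 0 1 (asym q R 3 s) = -(qC q ^ 2 • asym q R 3 s) := by
  simp only [asym_three, map_add, map_sub, ← braid_relation_apply, hecke_01]
  module

/-- The straightening rules for 2-forms. -/
theorem exchange_two {s : Word 2 → R} (hs : s ∈ LinearMap.range (asym q R 2)) :
    (∀ a, s ![a, a] = 0) ∧ s ![.plus, .minus] = (-(qC q ^ 4)⁻¹) • s ![.minus, .plus] ∧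
      s ![.zed, .minus] = (-(qC q ^ 6)⁻¹) • s ![.minus, .zed] ∧
      s ![.zed, .plus] = (-qC q ^ 6) • s ![.plus, .zed] := by
  obtain ⟨t, rfl⟩ := hs
  refine exchange_of_braid q (fun p => asym q R 2 t ![p.1, p.2]) fun ⟨a, b⟩ => ?_
  rw [← braidAt_two, braidAt_asym_two]
  rfl

/-- The straightening rules for the first two factors of a 3-form. -/
theorem exchange_01 {s : Word 3 → R} (hs : s ∈ LinearMap.range (asym q R 3)) (c : Idx) :
    (∀ a, s ![a, a, c] = 0) ∧ s ![.plus, .minus, c] = (-(qC q ^ 4)⁻¹) • s ![.minus, .plus, c] ∧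
      s ![.zed, .minus, c] = (-(qC q ^ 6)⁻¹) • s ![.minus, .zed, c] ∧
      s ![.zed, .plus, c] = (-qC q ^ 6) • s ![.plus, .zed, c] := by
  obtain ⟨t, rfl⟩ := hs
  refine exchange_of_braid q (fun p => asym q R 3 t ![p.1, p.2, c]) fun ⟨a, b⟩ => ?_
  rw [← braidAt_01, braidAt_01_asym_three]
  rfl

/-- The straightening rules for the last two factors of a 3-form. -/
theorem exchange_12 {s : Word 3 → R} (hs : s ∈ LinearMap.range (asym q R 3)) (c : Idx) :
    (∀ a, s ![c, a, a] = 0) ∧ s ![c, .plus, .minus] = (-(qC q ^ 4)⁻¹) • s ![c, .minus, .plus] ∧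
      s ![c, .zed, .minus] = (-(qC q ^ 6)⁻¹) • s ![c, .minus, .zed] ∧
      s ![c, .zed, .plus] = (-qC q ^ 6) • s ![c, .plus, .zed] := by
  obtain ⟨t, rfl⟩ := hs
  refine exchange_of_braid q (fun p => asym q R 3 t ![c, p.1, p.2]) fun ⟨a, b⟩ => ?_
  rw [← braidAt_12, braidAt_12_asym_three]
  rfl

/-- All coefficients of a 3-form in terms of the coefficient of `ω_- ⊗ ω_+ ⊗ ω_z`; there are
non-zero ones only at the six permutations of `(-,+,z)`. -/
theorem straighten_three {s : Word 3 → R} (hs : s ∈ LinearMap.range (asym q R 3)) (a b c : Idx) :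
    s ![a, b, c] = (match a, b, c with
      | .minus, .plus, .zed => (1 : ℂ)
      | .minus, .zed, .plus => -qC q ^ 6
      | .plus, .minus, .zed => -(qC q ^ 4)⁻¹
      | .plus, .zed, .minus => (qC q ^ 10)⁻¹
      | .zed, .minus, .plus => 1
      | .zed, .plus, .minus => -(qC q ^ 4)⁻¹
      | _, _, _ => 0) • s topWord := by
  have hq := qC_ne_zero q
  have h01 := exchange_01 q hs
  have h12 := exchange_12 q hs
  have d01 := fun c => (h01 c).1
  have d12 := fun c => (h12 c).1
  have r1 := fun c => (h01 c).2.1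
  have r2 := fun c => (h01 c).2.2.1
  have r3 := fun c => (h01 c).2.2.2
  have r4 := fun c => (h12 c).2.1
  have r5 := fun c => (h12 c).2.2.1
  have r6 := fun c => (h12 c).2.2.2
  cases a <;> cases b <;> cases c <;>
    simp only [r1, r2, r3, r4, r5, r6, d01, d12, smul_zero, zero_smul, smul_smul, topWord] <;>
    first
    | done
    | exact (one_smul _ _).symm
    | (congr 1; field_simp)

/-- The coefficient of `A⁽³⁾ s` at `ω_- ⊗ ω_+ ⊗ ω_z`. -/
theorem asym_three_topWord (s : Word 3 → R) : asym q R 3 s topWord =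
    qC q ^ 4 • s ![.minus, .plus, .zed] - s ![.minus, .zed, .plus]
      - qC q ^ 6 • s ![.plus, .minus, .zed] + qC q ^ 10 • s ![.plus, .zed, .minus]
      + qC q ^ 4 • s ![.zed, .minus, .plus] - qC q ^ 6 • s ![.zed, .plus, .minus] := by
  have hq := qC_ne_zero q
  rw [asym_three]
  simp only [Pi.add_apply, Pi.sub_apply, topWord, braidAt_01, braidAt_12, braid_sum]
  match_scalars <;> field_simp <;> ring
end

/-- A basis of the left-invariant `k`-forms dual to a family of coefficients: every `k`-form is
the combination of the forms `vec i` with its own coefficients at the words `word i`. -/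
structure Frame (q : Set.Ioo (0 : ℝ) 1) (k : ℕ) (ι : Type) [Fintype ι] [DecidableEq ι] where
  word : ι → Word k
  vec : ι → Word k → ℂ
  vec_mem : ∀ i, vec i ∈ invForms q k
  vec_word : ∀ i j, vec i (word j) = if i = j then 1 else 0
  expand : ∀ {R : Type} [Ring R] [Algebra ℂ R] {s : Word k → R},
    s ∈ LinearMap.range (asym q R k) → ∀ w, s w = ∑ i, vec i w • s (word i)

/-- The constant function `1`. -/
def frameZero (q : Set.Ioo (0 : ℝ) 1) : Frame q 0 Unit where
  word _ := ![]
  vec _ := 1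
  vec_mem _ := ⟨1, rfl⟩
  vec_word i j := rfl
  expand _ w := by
    simp [Subsingleton.elim w ![]]

/-- The forms `ω_a`. -/
def frameOne (q : Set.Ioo (0 : ℝ) 1) : Frame q 1 Idx where
  word a := ![a]
  vec a := Pi.single ![a] 1
  vec_mem a := ⟨Pi.single ![a] 1, rfl⟩
  vec_word a b := by
    rw [Pi.single_apply]
    simp [funext_iff, eq_comm]
  expand {R} _ _ s _ w := by
    have : w = ![w 0] := by funext i; fin_cases i; rfl
    rw [this, Finset.sum_eq_single (w 0)]
    · simp
    · intro b _ hb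
      rw [Pi.single_eq_of_ne, zero_smul]
      simpa [funext_iff, eq_comm] using hb
    · simp

/-- The words `(-,z)`, `(+,z)`, `(-,+)` at which the coefficients of 2-forms are read. The label is
that of the 1-form `ω_a` which the Hodge operator takes to the corresponding 2-form. -/
def wordTwo : Idx → Word 2
  | .minus => ![.minus, .zed]
  | .plus => ![.plus, .zed]
  | .zed => ![.minus, .plus]

/-- The coefficient of `ω_a ∧ ω_b` at the word `(a, b)`, for `(a, b)` in `wordTwo`. -/
def scaleTwo (q : Set.Ioo (0 : ℝ) 1) : Idx → ℂ
  | .minus => qC q ^ 2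
  | .plus => 1
  | .zed => qC q ^ 2

theorem scaleTwo_ne_zero (q : Set.Ioo (0 : ℝ) 1) (a : Idx) : scaleTwo q a ≠ 0 := by
  have := qC_ne_zero q
  cases a <;> simp [scaleTwo, this]

theorem asym_single_wordTwo (q : Set.Ioo (0 : ℝ) 1) {R : Type*} [Ring R] [Algebra ℂ R]
    (a b : Idx) : asym q R 2 (Pi.single (wordTwo a) 1) (wordTwo b) =
      if a = b then algebraMap ℂ R (scaleTwo q a) else 0 := by
  have h : ∀ a b a' b' : Idx, (![a, b] = ![a', b']) ↔ (a = a' ∧ b = b') := by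
    intros
    simp [funext_iff, Fin.forall_fin_succ]
  rw [asym_two]
  cases a <;> cases b <;>
    simp only [Pi.sub_apply, wordTwo, braidAt_two, braid_sum] <;>
    simp [h, scaleTwo, Algebra.smul_def]

/-- The forms `ω_- ∧ ω_z`, `ω_+ ∧ ω_z`, `ω_- ∧ ω_+`, labelled by `-`, `+`, `z` and rescaled to have
coefficient `1` at their own word. -/
def frameTwo (q : Set.Ioo (0 : ℝ) 1) : Frame q 2 Idx where
  word := wordTwo
  vec a := (scaleTwo q a)⁻¹ • asym q ℂ 2 (Pi.single (wordTwo a) 1)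
  vec_mem a := ⟨(scaleTwo q a)⁻¹ • Pi.single (wordTwo a) 1, asym_smul q 2 _ _⟩
  vec_word a b := by
    rw [Pi.smul_apply, asym_single_wordTwo]
    split_ifs
    · exact inv_mul_cancel₀ (scaleTwo_ne_zero q a)
    · exact mul_zero _
  expand {R} _ _ s hs w := by
    have hv := fun a b => asym_single_wordTwo q (R := ℂ) a b
    have hm : ∀ a t, (scaleTwo q a)⁻¹ * (t * scaleTwo q a) = t := fun a t => by
      field_simp [scaleTwo_ne_zero q a]
    have hm' := fun a => inv_mul_cancel₀ (scaleTwo_ne_zero q a)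
    obtain ⟨a, b, rfl⟩ := word2 w
    obtain ⟨d, r1, r2, r3⟩ := exchange_two q hs
    have hrel := fun i => exchange_two q (⟨Pi.single (wordTwo i) 1, rfl⟩ :
      asym q ℂ 2 (Pi.single (wordTwo i) 1) ∈ LinearMap.range (asym q ℂ 2))
    have d' := fun i => (hrel i).1
    have r1' := fun i => (hrel i).2.1
    have r2' := fun i => (hrel i).2.2.1
    have r3' := fun i => (hrel i).2.2.2
    have v1 := fun i => hv i .minus
    have v2 := fun i => hv i .plus
    have v3 := fun i => hv i .zed
    change ∀ i, asym q ℂ 2 _ ![.minus, .zed] = _ at v1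
    change ∀ i, asym q ℂ 2 _ ![.plus, .zed] = _ at v2
    change ∀ i, asym q ℂ 2 _ ![.minus, .plus] = _ at v3
    cases a <;> cases b <;>
      simp [d, r1, r2, r3, d', r1', r2', r3', v1, v2, v3, hm', -neg_smul] <;>
      simp [wordTwo, hm]

/-- The form `θ`, rescaled to have coefficient `1` at `(-,+,z)`. -/
def frameThree (q : Set.Ioo (0 : ℝ) 1) : Frame q 3 Unit where
  word _ := topWord
  vec _ := (qC q ^ 4)⁻¹ • asym q ℂ 3 (Pi.single topWord 1)
  vec_mem _ := ⟨(qC q ^ 4)⁻¹ • Pi.single topWord 1, asym_smul q 3 _ _⟩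
  vec_word _ _ := by
    rw [Pi.smul_apply, asym_three_topWord]
    simp [topWord, funext_iff, Fin.forall_fin_succ, qC_ne_zero]
  expand {R} _ _ s hs w := by
    obtain ⟨a, b, c, rfl⟩ := word3 w
    have hq := pow_ne_zero 4 (qC_ne_zero q)
    have ht : asym q ℂ 3 (Pi.single topWord 1) topWord = qC q ^ 4 := by
      rw [asym_three_topWord]
      simp [topWord, funext_iff, Fin.forall_fin_succ]
    rw [straighten_three q hs, Fintype.sum_unique, Pi.smul_apply,
      straighten_three q (⟨Pi.single topWord 1, rfl⟩ :
        asym q ℂ 3 (Pi.single topWord 1) ∈ LinearMap.range (asym q ℂ 3)) a b c, ht,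
      smul_comm, smul_eq_mul _ (qC q ^ 4), inv_mul_cancel₀ hq, smul_eq_mul, mul_one]

/-! ### The duality condition in coordinates -/

theorem conj_qC (q : Set.Ioo (0 : ℝ) 1) : starRingEnd ℂ (qC q) = qC q :=
  Complex.conj_ofReal _

/-- The Haar state of one coefficient of `φ* ⊗ ψ`, without the sign of the involution; `w` is the
word of the coefficient. -/
def pairing (q : Set.Ioo (0 : ℝ) 1) {k l : ℕ} (h : k + l = 3) (φ : Word k → SUq q)
    (ψ : Word l → SUq q) (w : Word 3) : ℂ :=
  haar q (star (φ fun i => (w (Fin.cast h (Fin.castAdd l i.rev))).bar) *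
    ψ fun i => w (Fin.cast h (Fin.natAdd k i)))

theorem haar_tensorMul_starTensor (q : Set.Ioo (0 : ℝ) 1) {k l : ℕ} (φ : Word k → SUq q)
    (ψ : Word l → SUq q) (w : Word (k + l)) :
    haar q (tensorMul q (starTensor q φ) ψ w) = (-1) ^ (k * (k - 1) / 2 + k) *
      haar q (star (φ fun i => (w (Fin.castAdd l i.rev)).bar) * ψ fun i => w (Fin.natAdd k i)) := by
  have hs : ∀ (n : ℕ) (y : SUq q), (-1 : SUq q) ^ n * y = ((-1 : ℂ) ^ n) • y := fun n y => by
    rw [Algebra.smul_def, map_pow, map_neg, map_one]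
  rw [tensorMul, starTensor, hs, smul_mul_assoc, ← map_mul, map_smul, haar_twist, smul_eq_mul]

theorem asym_cast_topWord (q : Set.Ioo (0 : ℝ) 1) {n : ℕ} (hn : n = 3) (s : Word n → SUq q) :
    asym q (SUq q) n s (fun i => topWord (Fin.cast hn i)) =
      asym q (SUq q) 3 (fun w => s fun i => w (Fin.cast hn i)) topWord := by
  subst hn
  rfl

/-- The Haar state absorbs the twists which arise when the coefficients of the second factor are
moved past the forms of the first one, so `∫ φ* ∧ ψ` is a combination of the six numbers
`h(φ_v* ψ_w)` with `v`, `w` complementary in a permutation of `(-,+,z)`. -/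
theorem integral_wedge_star (q : Set.Ioo (0 : ℝ) 1) (m : ℝ) {k l : ℕ} (h : k + l = 3)
    (φ : forms q k) (ψ : forms q l) :
    integral q m h (wedge q (starForm q φ) ψ) =
      (m * qC q ^ 4 : ℂ)⁻¹ * ((lam q k * lam q l : ℝ) : ℂ)⁻¹ * (-1) ^ (k * (k - 1) / 2 + k) *
        (qC q ^ 4 * pairing q h φ.1 ψ.1 ![.minus, .plus, .zed]
          - pairing q h φ.1 ψ.1 ![.minus, .zed, .plus]
          - qC q ^ 6 * pairing q h φ.1 ψ.1 ![.plus, .minus, .zed]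
          + qC q ^ 10 * pairing q h φ.1 ψ.1 ![.plus, .zed, .minus]
          + qC q ^ 4 * pairing q h φ.1 ψ.1 ![.zed, .minus, .plus]
          - qC q ^ 6 * pairing q h φ.1 ψ.1 ![.zed, .plus, .minus]) := by
  have e : ∀ w : Word 3, haar q (tensorMul q (starTensor q φ.1) ψ.1 fun i => w (Fin.cast h i)) =
      (-1) ^ (k * (k - 1) / 2 + k) * pairing q h φ.1 ψ.1 w := fun w =>
    haar_tensorMul_starTensor q φ.1 ψ.1 _
  change haar q (_ • asym q (SUq q) (k + l) (_ • tensorMul q (starTensor q φ.1) ψ.1) _) = _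
  rw [asym_smul, Pi.smul_apply, asym_cast_topWord, asym_three_topWord]
  simp only [map_smul, map_add, map_sub, smul_eq_mul, e]
  ring

/-- The scalar product and the integral are compatible in a single degree. -/
def IsDualAt (q : Set.Ioo (0 : ℝ) 1) (g : Contraction) (m : ℝ) {k l : ℕ} (h : k + l = 3)
    (T : forms q k →ₗ[ℂ] forms q l) : Prop :=
  ∀ (x x' : SUq q) (ω ω' : invForms q k), scal q g x ω x' ω' =
    integral q m h (wedge q (starForm q (form q x ω)) (T (form q x' ω')))

theorem form_word (q : Set.Ioo (0 : ℝ) 1) {k : ℕ} (x : SUq q) (ω : invForms q k) (w : Word k) :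
    (form q x ω).1 w = ω.1 w • x := by
  change x * algebraMap ℂ (SUq q) (ω.1 w) = _
  rw [← Algebra.commutes, ← Algebra.smul_def]

namespace Frame

variable {q : Set.Ioo (0 : ℝ) 1} {k l : ℕ} {ι : Type} [Fintype ι] [DecidableEq ι]

/-- A form is determined by its coefficients at the words of a frame. -/
theorem ext_forms (F : Frame q k ι) {φ ψ : forms q k}
    (h : ∀ i, φ.1 (F.word i) = ψ.1 (F.word i)) : φ = ψ := by
  refine Subtype.ext (funext fun w => ?_)
  rw [F.expand φ.2, F.expand ψ.2]
  exact Finset.sum_congr rfl fun i _ => by rw [h]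

theorem eq_sum_form (F : Frame q k ι) (φ : forms q k) :
    φ = ∑ i, form q (φ.1 (F.word i)) ⟨F.vec i, F.vec_mem i⟩ := by
  refine F.ext_forms fun j => ?_
  rw [AddSubmonoidClass.coe_finsetSum, Finset.sum_apply, Finset.sum_eq_single j]
  · rw [form_word]
    simp [F.vec_word]
  · intro i _ hi
    rw [form_word]
    simp [F.vec_word, hi]
  · simp

/-- The `SU_q(2)`-linear map of forms that multiplies the `i`-th coefficient by `t i`. -/
def diag (F : Frame q k ι) (F' : Frame q l ι) (t : ι → ℂ) : forms q k →ₗ[SUq q] forms q l where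
  toFun φ := ∑ i, form q (t i • φ.1 (F.word i)) ⟨F'.vec i, F'.vec_mem i⟩
  map_add' φ ψ := by
    rw [← Finset.sum_add_distrib]
    refine Finset.sum_congr rfl fun i _ => ?_
    rw [form, form, form, ← add_smul, ← smul_add]
    rfl
  map_smul' x φ := by
    rw [RingHom.id_apply, Finset.smul_sum]
    refine Finset.sum_congr rfl fun i _ => ?_
    rw [form, form, smul_smul, mul_smul_comm]
    rfl

theorem diag_word (F : Frame q k ι) (F' : Frame q l ι) (t : ι → ℂ) (φ : forms q k) (j : ι) :
    (F.diag F' t φ).1 (F'.word j) = t j • φ.1 (F.word j) := by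
  change (∑ i, form q (t i • φ.1 (F.word i)) ⟨F'.vec i, F'.vec_mem i⟩ : forms q l).1 _ = _
  rw [AddSubmonoidClass.coe_finsetSum, Finset.sum_apply, Finset.sum_eq_single j]
  · rw [form_word]
    simp [F'.vec_word]
  · intro i _ hi
    rw [form_word]
    simp [F'.vec_word, hi]
  · simp

/-- If the contraction and the integral are diagonal in a pair of frames, an operator is dual to
the scalar product precisely when it is diagonal with the quotients as entries: the Haar state is
faithful, so the first argument `x` can be cancelled. -/
theorem isDualAt_iff (F : Frame q k ι) (F' : Frame q l ι) {g : Contraction} {m : ℝ}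
    (h : k + l = 3) (G P : ι → ℂ) (hP0 : ∀ i, P i ≠ 0)
    (hG : ∀ ω ω' : invForms q k, contract g (starConst ω.1) ω'.1 =
      ∑ i, G i * (starRingEnd ℂ (ω.1 (F.word i)) * ω'.1 (F.word i)))
    (hP : ∀ (φ : forms q k) (ψ : forms q l), integral q m h (wedge q (starForm q φ) ψ) =
      ∑ i, P i * haar q (star (φ.1 (F.word i)) * ψ.1 (F'.word i)))
    (T : forms q k →ₗ[ℂ] forms q l) :
    IsDualAt q g m h T ↔
      ∀ φ i, (T φ).1 (F'.word i) = (G i / (lam q k * P i)) • φ.1 (F.word i) := by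
  have hl : (lam q k : ℂ) ≠ 0 := Complex.ofReal_ne_zero.mpr (lam_pos q k).ne'
  constructor
  · intro hT
    have key : ∀ x' (ω' : invForms q k) i, (T (form q x' ω')).1 (F'.word i) =
        (G i / (lam q k * P i)) • (form q x' ω').1 (F.word i) := fun x' ω' i => by
      refine eq_of_haar_star_mul q fun x => ?_
      have e := hT x x' ⟨F.vec i, F.vec_mem i⟩ ω'
      rw [scal, hG, hP, Finset.sum_eq_single i, Finset.sum_eq_single i] at e
      · simp only [form_word, F.vec_word, if_true, map_one, one_smul] at e ⊢
        refine mul_left_cancel₀ (hP0 i) (e.symm.trans ?_)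
        have hi := hP0 i
        simp only [mul_smul_comm, map_smul, smul_eq_mul, one_mul]
        push_cast
        field_simp
      · intro j _ hj
        simp [form_word, F.vec_word, Ne.symm hj]
      · simp
      · intro j _ hj
        simp [F.vec_word, Ne.symm hj]
      · simp
    intro φ i
    rw [F.eq_sum_form φ, map_sum, AddSubmonoidClass.coe_finsetSum, AddSubmonoidClass.coe_finsetSum,
      Finset.sum_apply, Finset.sum_apply, Finset.smul_sum]
    exact Finset.sum_congr rfl fun j _ => key _ _ _
  · intro hT x x' ω ω'
    rw [scal, hG, hP, Finset.mul_sum]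
    refine Finset.sum_congr rfl fun i _ => ?_
    have hi := hP0 i
    rw [hT, form_word, form_word, star_smul]
    simp only [mul_smul_comm, smul_mul_assoc, map_smul, smul_eq_mul, Complex.star_def]
    push_cast
    field_simp

end Frame

/-! ### The integral in coordinates -/

section
variable (q : Set.Ioo (0 : ℝ) 1)

theorem pairing_zero_three (h : 0 + 3 = 3) (φ : Word 0 → SUq q) (ψ : Word 3 → SUq q)
    (a b c : Idx) :
    pairing q h φ ψ ![a, b, c] = haar q (star (φ ![]) * ψ ![a, b, c]) := by
  unfold pairing
  congr 3
  · exact congrArg φ (Subsingleton.elim _ _)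
  · funext i; fin_cases i <;> rfl

theorem pairing_one_two (h : 1 + 2 = 3) (φ : Word 1 → SUq q) (ψ : Word 2 → SUq q)
    (a b c : Idx) :
    pairing q h φ ψ ![a, b, c] = haar q (star (φ ![a.bar]) * ψ ![b, c]) := by
  unfold pairing
  congr 3
  · exact congrArg φ (by funext i; fin_cases i; rfl)
  · funext i; fin_cases i <;> rfl

theorem pairing_two_one (h : 2 + 1 = 3) (φ : Word 2 → SUq q) (ψ : Word 1 → SUq q)
    (a b c : Idx) :
    pairing q h φ ψ ![a, b, c] = haar q (star (φ ![b.bar, a.bar]) * ψ ![c]) := by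
  unfold pairing
  congr 3
  · exact congrArg φ (by funext i; fin_cases i <;> rfl)
  · funext i; fin_cases i; rfl

theorem pairing_three_zero (h : 3 + 0 = 3) (φ : Word 3 → SUq q) (ψ : Word 0 → SUq q)
    (a b c : Idx) :
    pairing q h φ ψ ![a, b, c] = haar q (star (φ ![c.bar, b.bar, a.bar]) * ψ ![]) := by
  unfold pairing
  congr 3
  · exact congrArg φ (by funext i; fin_cases i <;> rfl)
  · exact Subsingleton.elim _ _

theorem haar_star_smul_mul (t : ℂ) (x y : SUq q) :
    haar q (star (t • x) * y) = starRingEnd ℂ t * haar q (star x * y) := by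
  rw [star_smul, smul_mul_assoc, map_smul]
  rfl

theorem haar_star_mul_smul (t : ℂ) (x y : SUq q) :
    haar q (star x * t • y) = t * haar q (star x * y) := by
  rw [mul_smul_comm, map_smul]
  rfl

theorem lam_two : (lam q 2 : ℂ) = 1 + qC q ^ 2 := by
  simp [lam, qC]

theorem lam_three : (lam q 3 : ℂ) = 1 + 2 * qC q ^ 2 + 2 * qC q ^ 4 + qC q ^ 6 := by
  simp [lam, qC]

theorem lam_ne_zero (k : ℕ) : (lam q k : ℂ) ≠ 0 :=
  Complex.ofReal_ne_zero.mpr (lam_pos q k).ne'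

/-- The entries of the pairing `∫ φ* ∧ ψ` of 1-forms with 2-forms, in either order, with respect to
`frameOne` and `frameTwo`. -/
def pairCoeff (m : ℝ) : Idx → ℂ
  | .minus => (m : ℂ)⁻¹
  | .plus => -(m : ℂ)⁻¹
  | .zed => -((qC q ^ 2)⁻¹ * (m : ℂ)⁻¹)

theorem pairCoeff_ne_zero {m : ℝ} (hm : m ≠ 0) (a : Idx) : pairCoeff q m a ≠ 0 := by
  have := qC_ne_zero q
  cases a <;> simp [pairCoeff, this, hm]

theorem integral_zero_three (m : ℝ) (h : 0 + 3 = 3)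
    (φ : forms q 0) (ψ : forms q 3) : integral q m h (wedge q (starForm q φ) ψ) =
      ∑ i, (m * qC q ^ 4 : ℂ)⁻¹ *
        haar q (star (φ.1 ((frameZero q).word i)) * ψ.1 ((frameThree q).word i)) := by
  have hq := qC_ne_zero q
  have hl := lam_ne_zero q 3
  have hL := lam_three q
  rw [integral_wedge_star, Complex.ofReal_mul, show lam q 0 = 1 from rfl]
  generalize (lam q 3 : ℂ) = L at hl hL
  simp only [pairing_zero_three]
  simp only [straighten_three q ψ.2, haar_star_mul_smul, Fintype.sum_unique, frameZero,
    frameThree]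
  push_cast
  field_simp
  rw [hL]
  ring

theorem integral_three_zero (m : ℝ) (h : 3 + 0 = 3)
    (φ : forms q 3) (ψ : forms q 0) : integral q m h (wedge q (starForm q φ) ψ) =
      ∑ i, (m * qC q ^ 4 : ℂ)⁻¹ *
        haar q (star (φ.1 ((frameThree q).word i)) * ψ.1 ((frameZero q).word i)) := by
  have hq := qC_ne_zero q
  have hl := lam_ne_zero q 3
  have hL := lam_three q
  rw [integral_wedge_star, Complex.ofReal_mul, show lam q 0 = 1 from rfl]
  generalize (lam q 3 : ℂ) = L at hl hL
  simp only [pairing_three_zero, Idx.bar]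
  simp only [straighten_three q φ.2, haar_star_smul_mul, Fintype.sum_unique, frameZero,
    frameThree, map_neg, map_inv₀, map_pow, conj_qC, map_one]
  push_cast
  field_simp
  rw [hL]
  ring

theorem integral_one_two (m : ℝ) (h : 1 + 2 = 3)
    (φ : forms q 1) (ψ : forms q 2) : integral q m h (wedge q (starForm q φ) ψ) =
      ∑ i, pairCoeff q m i *
        haar q (star (φ.1 ((frameOne q).word i)) * ψ.1 ((frameTwo q).word i)) := by
  have hq := qC_ne_zero q
  have hl := lam_ne_zero q 2
  have hL := lam_two q
  obtain ⟨-, r1, r2, r3⟩ := exchange_two q ψ.2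
  rw [integral_wedge_star, Complex.ofReal_mul, show lam q 1 = 1 from rfl]
  generalize (lam q 2 : ℂ) = L at hl hL
  simp only [pairing_one_two, Idx.bar]
  simp only [r1, r2, r3, haar_star_mul_smul, Idx.sum_eq, frameOne, frameTwo, wordTwo,
    pairCoeff]
  push_cast
  field_simp
  rw [hL]
  ring

theorem integral_two_one (m : ℝ) (h : 2 + 1 = 3)
    (φ : forms q 2) (ψ : forms q 1) : integral q m h (wedge q (starForm q φ) ψ) =
      ∑ i, pairCoeff q m i *
        haar q (star (φ.1 ((frameTwo q).word i)) * ψ.1 ((frameOne q).word i)) := by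
  have hq := qC_ne_zero q
  have hl := lam_ne_zero q 2
  have hL := lam_two q
  obtain ⟨-, r1, r2, r3⟩ := exchange_two q φ.2
  rw [integral_wedge_star, Complex.ofReal_mul, show lam q 1 = 1 from rfl]
  generalize (lam q 2 : ℂ) = L at hl hL
  simp only [pairing_two_one, Idx.bar]
  simp only [r1, r2, r3, haar_star_smul_mul, Idx.sum_eq, frameOne, frameTwo, wordTwo,
    pairCoeff, map_neg, map_inv₀, map_pow, conj_qC]
  push_cast
  field_simp
  rw [hL]
  ring

end

/-! ### The contraction in coordinates -/

/-- The coefficient `g(ω_a, ω_(bar a))` of `contraction α β γ`. -/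
def contractionCoeff (α β γ : ℂ) : Idx → ℂ
  | .minus => α
  | .plus => β
  | .zed => γ

theorem contraction_single (α β γ : ℂ) (a b : Idx) :
    contraction α β γ (Pi.single a 1) (Pi.single b 1) =
      if b = a.bar then contractionCoeff α β γ a else 0 := by
  cases a <;> cases b <;> simp [contraction, Idx.bar, contractionCoeff]

theorem contract_contraction (α β γ : ℂ) {k : ℕ} (s t : Word k → ℂ) :
    contract (contraction α β γ) s t =
      ∑ v, s v * t (fun i => (v i).bar) * ∏ i, contractionCoeff α β γ (v i) := by
  unfold contract
  refine Finset.sum_congr rfl fun v _ => ?_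
  rw [Finset.sum_eq_single fun i => (v i).bar]
  · simp [contraction_single]
  · intro w _ hw
    obtain ⟨i, hi⟩ := Function.ne_iff.mp hw
    rw [Finset.prod_eq_zero (Finset.mem_univ i), mul_zero]
    rw [contraction_single, if_neg hi]
  · simp

theorem sum_word_succ {M : Type*} [AddCommMonoid M] (n : ℕ) (f : Word (n + 1) → M) :
    ∑ w, f w = ∑ a, ∑ w : Word n, f (Matrix.vecCons a w) := by
  rw [← (Fin.consEquiv fun _ : Fin (n + 1) => Idx).sum_comp f, Fintype.sum_prod_type]
  rfl

theorem sum_word_zero {M : Type*} [AddCommMonoid M] (f : Word 0 → M) :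
    ∑ w, f w = f ![] := by
  rw [Fintype.sum_unique]
  exact congrArg f (Subsingleton.elim _ _)

section
variable (q : Set.Ioo (0 : ℝ) 1) (α β γ : ℂ)

/-- The diagonal Gram matrix `g(ω*, ω')` of the 1-forms, in the coefficients of `frameOne`. -/
def gramOne : Idx → ℂ
  | .minus => -β
  | .plus => -α
  | .zed => -γ

/-- The diagonal Gram matrix `g(ω*, ω')` of the 2-forms, in the coefficients of `frameTwo`. -/
def gramTwo : Idx → ℂ
  | .minus => 2 * (qC q ^ 6)⁻¹ * (β * γ)
  | .plus => 2 * qC q ^ 6 * (α * γ)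
  | .zed => 2 * (qC q ^ 4)⁻¹ * (α * β)

theorem contract_zero (ω ω' : invForms q 0) :
    contract (contraction α β γ) (starConst ω.1) ω'.1 =
      ∑ i, 1 * (starRingEnd ℂ (ω.1 ((frameZero q).word i)) * ω'.1 ((frameZero q).word i)) := by
  rw [contract_contraction, sum_word_zero]
  simp [starConst, frameZero, Subsingleton.elim _ (![] : Word 0)]

theorem contract_one (ω ω' : invForms q 1) :
    contract (contraction α β γ) (starConst ω.1) ω'.1 =
      ∑ i, gramOne α β γ i *
        (starRingEnd ℂ (ω.1 ((frameOne q).word i)) * ω'.1 ((frameOne q).word i)) := by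
  have h1 : ∀ a : Idx, starConst ω.1 ![a] = -starRingEnd ℂ (ω.1 ![a.bar]) := fun a => by
    rw [starConst, show (fun i : Fin 1 => (![a] i.rev).bar) = ![a.bar] by
      funext i; fin_cases i; rfl]
    norm_num
  have h2 : ∀ a : Idx, (fun i : Fin 1 => (![a] i).bar) = ![a.bar] := fun a => by
    funext i; fin_cases i; rfl
  rw [contract_contraction]
  simp only [sum_word_succ, sum_word_zero, h1, h2]
  simp only [Fin.prod_univ_one, Matrix.cons_val_zero,
    Idx.sum_eq, Idx.bar, contractionCoeff, gramOne, frameOne]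
  ring

theorem contract_two (ω ω' : invForms q 2) :
    contract (contraction α β γ) (starConst ω.1) ω'.1 =
      ∑ i, gramTwo q α β γ i *
        (starRingEnd ℂ (ω.1 ((frameTwo q).word i)) * ω'.1 ((frameTwo q).word i)) := by
  have hq := qC_ne_zero q
  have h1 : ∀ a b : Idx, starConst ω.1 ![a, b] = -starRingEnd ℂ (ω.1 ![b.bar, a.bar]) :=
    fun a b => by
      rw [starConst, show (fun i : Fin 2 => (![a, b] i.rev).bar) = ![b.bar, a.bar] by
        funext i; fin_cases i <;> rfl]
      norm_num
  have h2 : ∀ a b : Idx, (fun i : Fin 2 => (![a, b] i).bar) = ![a.bar, b.bar] := fun a b => by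
    funext i; fin_cases i <;> rfl
  obtain ⟨d, r1, r2, r3⟩ := exchange_two q ω.2
  obtain ⟨d', r1', r2', r3'⟩ := exchange_two q ω'.2
  rw [contract_contraction]
  simp only [sum_word_succ, sum_word_zero, h1, h2]
  simp only [Fin.prod_univ_two, Matrix.cons_val_zero,
    Matrix.cons_val_one, Idx.sum_eq, Idx.bar, contractionCoeff, gramTwo, frameTwo, wordTwo,
    d, r1, r2, r3, d', r1', r2', r3', smul_eq_mul, map_mul, map_neg, map_inv₀, map_pow, conj_qC,
    map_zero, mul_zero, zero_mul, neg_zero, zero_add, add_zero]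
  field_simp
  ring

theorem contract_three (ω ω' : invForms q 3) :
    contract (contraction α β γ) (starConst ω.1) ω'.1 =
      ∑ i, (-6 * (qC q ^ 4)⁻¹ * (α * β * γ)) *
        (starRingEnd ℂ (ω.1 ((frameThree q).word i)) * ω'.1 ((frameThree q).word i)) := by
  have hq := qC_ne_zero q
  have h1 : ∀ a b c : Idx, starConst ω.1 ![a, b, c] =
      starRingEnd ℂ (ω.1 ![c.bar, b.bar, a.bar]) := fun a b c => by
    rw [starConst, show (fun i : Fin 3 => (![a, b, c] i.rev).bar) = ![c.bar, b.bar, a.bar] by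
      funext i; fin_cases i <;> rfl]
    norm_num
  have h2 : ∀ a b c : Idx, (fun i : Fin 3 => (![a, b, c] i).bar) = ![a.bar, b.bar, c.bar] :=
    fun a b c => by funext i; fin_cases i <;> rfl
  rw [contract_contraction]
  simp only [sum_word_succ, sum_word_zero, h1, h2]
  simp only [Fin.prod_univ_three, Matrix.cons_val_zero,
    Matrix.cons_val_one, Matrix.cons_val, Idx.sum_eq, Idx.bar, contractionCoeff]
  simp only [straighten_three q ω.2, straighten_three q ω'.2, smul_eq_mul, map_mul, map_neg,
    map_inv₀, map_pow, conj_qC, map_zero, map_one, mul_zero, zero_mul, zero_add,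
    add_zero, Fintype.sum_unique, frameThree]
  field_simp
  ring
end

/-! ### Invariant contractions -/

theorem contraction_ext {g : Contraction} {α β γ : ℂ}
    (h : ∀ a b : Idx, g (Pi.single a 1) (Pi.single b 1) =
      if b = a.bar then contractionCoeff α β γ a else 0) : g = contraction α β γ :=
  LinearMap.BilinForm.ext_basis (Pi.basisFun ℂ Idx) fun a b => by
    rw [Pi.basisFun_apply, Pi.basisFun_apply, h, contraction_single]

/-- Invariance means that `g(ω_a, ω_b)` vanishes unless the degrees of `ω_a` and `ω_b` add up to
zero, that is, unless `b` is the label of `ω_a*`. -/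
theorem rightInvariant_iff (g : Contraction) :
    RightInvariant g ↔ ∃ α β γ : ℂ, g = contraction α β γ := by
  constructor
  · intro h
    -- Comparison of the constant terms in `g_ab z ^ (n_a + n_b) = g_ab`.
    have key : ∀ a b : Idx, a.degree + b.degree ≠ 0 →
        g (Pi.single a 1) (Pi.single b 1) = 0 := fun a b hab => by
      have e := h (Pi.single a 1) (Pi.single b 1)
      rw [Finset.sum_eq_single a, Finset.sum_eq_single b] at e
      · simp only [coaction, Pi.single_eq_same, map_one, one_mul] at e
        rw [← LaurentPolynomial.T_add, ← LaurentPolynomial.single_eq_C_mul_T] at e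
        have e0 := congrArg (fun p : LaurentPolynomial ℂ => p.coeff 0) e
        simpa only [AddMonoidAlgebra.coeff_single, LaurentPolynomial.C_apply, Finsupp.single_apply,
          hab, if_false, if_true] using e0.symm
      · intro c _ hc
        simp [coaction, Pi.single_eq_of_ne hc]
      · simp
      · intro c _ hc
        simp [coaction, Pi.single_eq_of_ne hc]
      · simp
    refine ⟨g (Pi.single .minus 1) (Pi.single .plus 1), g (Pi.single .plus 1) (Pi.single .minus 1),
      g (Pi.single .zed 1) (Pi.single .zed 1), contraction_ext fun a b => ?_⟩
    cases a <;> cases b <;>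
      first
      | rfl
      | exact key _ _ (by decide)
  · rintro ⟨α, β, γ, rfl⟩ v w
    have hT : ∀ (n : ℤ) (x y : ℂ), LaurentPolynomial.C x * LaurentPolynomial.T n *
        (LaurentPolynomial.C y * LaurentPolynomial.T (-n)) = LaurentPolynomial.C (x * y) :=
      fun n x y => by
        rw [mul_mul_mul_comm, ← LaurentPolynomial.T_add, add_neg_cancel, LaurentPolynomial.T_zero,
          mul_one, map_mul]
    have h1 := hT (-2) (v .minus) (w .plus)
    have h2 := hT 2 (v .plus) (w .minus)
    have h3 := hT 0 (v .zed) (w .zed)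
    simp only [neg_neg, neg_zero] at h1 h2 h3
    simp only [contraction_single, Idx.sum_eq, Idx.bar, contractionCoeff, coaction, Idx.degree,
      h1, h2, h3, reduceCtorEq, if_true, if_false, map_zero, zero_mul, zero_add, add_zero,
      ← map_mul, ← map_add]
    refine congrArg LaurentPolynomial.C ?_
    simp only [contraction, LinearMap.mk₂_apply]
    ring

theorem contraction_nondegenerate_iff (α β γ : ℂ) :
    (contraction α β γ).Nondegenerate ↔ α * β * γ ≠ 0 := by
  have hg : ∀ v w : Idx → ℂ, contraction α β γ v w =
      α * v .minus * w .plus + β * v .plus * w .minus + γ * v .zed * w .zed := fun v w => rfl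
  constructor
  · intro h h0
    have key : ∀ a : Idx, contractionCoeff α β γ a ≠ 0 := fun a ha => by
      have : (Pi.single a 1 : Idx → ℂ) = 0 := h.1 _ fun w => by
        rw [hg]
        cases a <;> simp_all [contractionCoeff]
      simpa using congrFun this a
    exact mul_ne_zero (mul_ne_zero (key .minus) (key .plus)) (key .zed) h0
  · intro h
    have hα : α ≠ 0 := fun e => h (by simp [e])
    have hβ : β ≠ 0 := fun e => h (by simp [e])
    have hγ : γ ≠ 0 := fun e => h (by simp [e])
    constructor
    · intro v hv
      have h1 := hv (Pi.single .plus 1)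
      have h2 := hv (Pi.single .minus 1)
      have h3 := hv (Pi.single .zed 1)
      simp only [hg] at h1 h2 h3
      funext a
      cases a <;> simp_all
    · intro v hv
      have h1 := hv (Pi.single .plus 1)
      have h2 := hv (Pi.single .minus 1)
      have h3 := hv (Pi.single .zed 1)
      simp only [hg] at h1 h2 h3
      funext a
      cases a <;> simp_all

/-! ### The Hodge operator -/

section
variable (q : Set.Ioo (0 : ℝ) 1)

theorem isDual_iff (g : Contraction) (m : ℝ) (T : FormOperator q) :
    IsDual q g m T ↔ ∀ k l (h : k + l = 3), IsDualAt q g m h (T k l h) :=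
  Iff.rfl

theorem vol_coeff_ne_zero {m : ℝ} (hm : m ≠ 0) : (m * qC q ^ 4 : ℂ)⁻¹ ≠ 0 :=
  inv_ne_zero (mul_ne_zero (Complex.ofReal_ne_zero.mpr hm) (pow_ne_zero 4 (qC_ne_zero q)))

variable (α β γ : ℂ) {m : ℝ}

theorem isDualAt_zero (hm : m ≠ 0) (T : forms q 0 →ₗ[ℂ] forms q 3) :
    IsDualAt q (contraction α β γ) m rfl T ↔ ∀ φ i, (T φ).1 ((frameThree q).word i) =
      (1 / (lam q 0 * (m * qC q ^ 4 : ℂ)⁻¹)) • φ.1 ((frameZero q).word i) :=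
  (frameZero q).isDualAt_iff (frameThree q) _ (fun _ => 1) (fun _ => (m * qC q ^ 4 : ℂ)⁻¹)
    (fun _ => vol_coeff_ne_zero q hm) (contract_zero q α β γ) (integral_zero_three q m _) T

theorem isDualAt_one (hm : m ≠ 0) (T : forms q 1 →ₗ[ℂ] forms q 2) :
    IsDualAt q (contraction α β γ) m rfl T ↔ ∀ φ i, (T φ).1 ((frameTwo q).word i) =
      (gramOne α β γ i / (lam q 1 * pairCoeff q m i)) • φ.1 ((frameOne q).word i) :=
  (frameOne q).isDualAt_iff (frameTwo q) _ _ _ (pairCoeff_ne_zero q hm)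
    (contract_one q α β γ) (integral_one_two q m _) T

theorem isDualAt_two (hm : m ≠ 0) (T : forms q 2 →ₗ[ℂ] forms q 1) :
    IsDualAt q (contraction α β γ) m rfl T ↔ ∀ φ i, (T φ).1 ((frameOne q).word i) =
      (gramTwo q α β γ i / (lam q 2 * pairCoeff q m i)) • φ.1 ((frameTwo q).word i) :=
  (frameTwo q).isDualAt_iff (frameOne q) _ _ _ (pairCoeff_ne_zero q hm)
    (contract_two q α β γ) (integral_two_one q m _) T

theorem isDualAt_three (hm : m ≠ 0) (T : forms q 3 →ₗ[ℂ] forms q 0) :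
    IsDualAt q (contraction α β γ) m rfl T ↔ ∀ φ i, (T φ).1 ((frameZero q).word i) =
      ((-6 * (qC q ^ 4)⁻¹ * (α * β * γ)) / (lam q 3 * (m * qC q ^ 4 : ℂ)⁻¹)) •
        φ.1 ((frameThree q).word i) :=
  (frameThree q).isDualAt_iff (frameZero q) _ (fun _ => -6 * (qC q ^ 4)⁻¹ * (α * β * γ))
    (fun _ => (m * qC q ^ 4 : ℂ)⁻¹) (fun _ => vol_coeff_ne_zero q hm)
    (contract_three q α β γ) (integral_three_zero q m _) T

theorem Frame.eq_diag_iff {k l : ℕ} {ι : Type} [Fintype ι] [DecidableEq ι] (F : Frame q k ι)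
    (F' : Frame q l ι) (t : ι → ℂ) (T : forms q k →ₗ[ℂ] forms q l) :
    (∀ φ i, (T φ).1 (F'.word i) = t i • φ.1 (F.word i)) ↔
      T = (F.diag F' t).restrictScalars ℂ := by
  constructor
  · intro h
    exact LinearMap.ext fun φ => F'.ext_forms fun i => by
      rw [h]; exact (F.diag_word F' t φ i).symm
  · rintro rfl φ i
    exact F.diag_word F' t φ i

/-- In every degree there is exactly one dual operator, and it is linear over the algebra. -/
theorem exists_isDualAt_iff (hm : m ≠ 0) (k l : ℕ) (h : k + l = 3) :
    ∃ S : forms q k →ₗ[SUq q] forms q l, ∀ T : forms q k →ₗ[ℂ] forms q l,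
      IsDualAt q (contraction α β γ) m h T ↔ T = S.restrictScalars ℂ := by
  match k, l, h with
  | 0, 3, _ => exact ⟨_, fun T => (isDualAt_zero q α β γ hm T).trans (Frame.eq_diag_iff q _ _ _ T)⟩
  | 1, 2, _ => exact ⟨_, fun T => (isDualAt_one q α β γ hm T).trans (Frame.eq_diag_iff q _ _ _ T)⟩
  | 2, 1, _ => exact ⟨_, fun T => (isDualAt_two q α β γ hm T).trans (Frame.eq_diag_iff q _ _ _ T)⟩
  | 3, 0, _ =>
    exact ⟨_, fun T => (isDualAt_three q α β γ hm T).trans (Frame.eq_diag_iff q _ _ _ T)⟩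
  | 0, 0, h => omega
  | 0, 1, h => omega
  | 0, 2, h => omega
  | 0, l + 4, h => omega
  | 1, 0, h => omega
  | 1, 1, h => omega
  | 1, l + 3, h => omega
  | 2, 0, h => omega
  | 2, l + 2, h => omega
  | 3, l + 1, h => omega
  | k + 4, l, h => omega

theorem existsUnique_isDual (hm : m ≠ 0) : (∃! T, IsDual q (contraction α β γ) m T) ∧
    ∀ T, IsDual q (contraction α β γ) m T → IsLeftLinear q T := by
  choose S hS using exists_isDualAt_iff q α β γ hm
  refine ⟨⟨fun k l h => (S k l h).restrictScalars ℂ,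
    (isDual_iff q _ m _).mpr fun k l h => (hS k l h _).mpr rfl, fun T hT => ?_⟩,
    fun T hT k l h x φ => ?_⟩
  · funext k l h
    exact (hS k l h _).mp (hT k l h)
  · rw [(hS k l h _).mp (hT k l h)]
    exact (S k l h).map_smul x φ

end

/-! ### Values on the basis forms -/

section
variable (q : Set.Ioo (0 : ℝ) 1)

theorem wedge_omega (a b : Idx) : (wedge q (omega q a) (omega q b) : forms q 2).1 =
    asym q (SUq q) 2 (Pi.single ![a, b] 1) := by
  have h1 : ∀ a, omega q a = ⟨asym q (SUq q) 1 (Pi.single ![a] 1), _, rfl⟩ := fun a =>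
    Subtype.ext (by
      change (1 : SUq q) • incl q (Pi.single ![a] 1) = Pi.single ![a] 1
      rw [one_smul, incl_single])
  rw [h1, h1, wedge_asym]
  refine congrArg (asym q (SUq q) 2) ((tensorMul_single q _ _).trans ?_)
  exact congrArg (fun w : Word 2 => (Pi.single w 1 : Word 2 → SUq q))
    (by funext i; fin_cases i <;> rfl)

/-- The basis `ω_- ∧ ω_z`, `ω_+ ∧ ω_z`, `ω_- ∧ ω_+` of the 2-forms, labelled by the form `ω_a` to
which the Hodge operator takes it. -/
def basisTwo : Idx → forms q 2
  | .minus => wedge q (omega q .minus) (omega q .zed)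
  | .plus => wedge q (omega q .plus) (omega q .zed)
  | .zed => wedge q (omega q .minus) (omega q .plus)

theorem basisTwo_word (a b : Idx) : (basisTwo q a).1 ((frameTwo q).word b) =
    if a = b then algebraMap ℂ (SUq q) (scaleTwo q a) else 0 := by
  rw [← asym_single_wordTwo]
  cases a <;> exact congrFun (wedge_omega q _ _) _

theorem omega_word (a b : Idx) : (omega q a).1 ((frameOne q).word b) =
    if a = b then 1 else 0 := by
  rw [omega, form_word]
  refine (congrArg (· • (1 : SUq q)) ((frameOne q).vec_word a b)).trans ?_
  split_ifs <;> simp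

theorem oneForm_word (i : Unit) : (oneForm q).1 ((frameZero q).word i) = 1 := rfl

theorem theta_word (i : Unit) :
    (theta q).1 ((frameThree q).word i) = algebraMap ℂ (SUq q) (qC q ^ 4) :=
  theta_topWord q

theorem coe_smul_apply {k : ℕ} (t : ℂ) (φ : forms q k) (w : Word k) :
    (t • φ).1 w = t • φ.1 w := rfl

theorem smul_right_cancel_of_one {s t : ℂ} (h : s • (1 : SUq q) = t • (1 : SUq q)) : s = t := by
  simpa [haar_one] using congrArg (haar q) h

/-- The entries of the Hodge operator on 1-forms. -/
def hodgeOne (m α β γ : ℂ) : Idx → ℂ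
  | .minus => -(qC q ^ 2)⁻¹ * m * β
  | .plus => m * α
  | .zed => m * γ

/-- The entries of the Hodge operator on 2-forms. -/
def hodgeTwo (m α β γ : ℂ) : Idx → ℂ
  | .minus => 2 * (qC q ^ 4)⁻¹ * (lam q 2 : ℂ)⁻¹ * m * β * γ
  | .plus => -2 * qC q ^ 6 * (lam q 2 : ℂ)⁻¹ * m * α * γ
  | .zed => -2 * (lam q 2 : ℂ)⁻¹ * m * α * β

variable {q} {α β γ : ℂ} {m : ℝ} {T : FormOperator q}

theorem dual_oneForm (hm : m ≠ 0) (hT : IsDual q (contraction α β γ) m T) :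
    T 0 3 rfl (oneForm q) = vol q m := by
  have hm' : (m : ℂ) ≠ 0 := Complex.ofReal_ne_zero.mpr hm
  have hq := qC_ne_zero q
  refine (frameThree q).ext_forms fun i => ?_
  rw [(isDualAt_zero q α β γ hm _).mp (hT 0 3 rfl), vol, coe_smul_apply, oneForm_word, theta_word,
    Algebra.algebraMap_eq_smul_one, smul_smul, show lam q 0 = 1 from rfl, Complex.ofReal_one]
  congr 1
  field_simp

theorem dual_theta (hm : m ≠ 0) (hT : IsDual q (contraction α β γ) m T) :
    T 3 0 rfl (theta q) =
      (-6 * qC q ^ 4 * (lam q 3 : ℂ)⁻¹ * m * α * β * γ) • oneForm q := by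
  have hm' : (m : ℂ) ≠ 0 := Complex.ofReal_ne_zero.mpr hm
  have hq := qC_ne_zero q
  have hl := lam_ne_zero q 3
  refine (frameZero q).ext_forms fun i => ?_
  rw [(isDualAt_three q α β γ hm _).mp (hT 3 0 rfl), coe_smul_apply, oneForm_word, theta_word,
    Algebra.algebraMap_eq_smul_one, smul_smul]
  congr 1
  field_simp

theorem dual_one_word (hm : m ≠ 0) (hT : IsDual q (contraction α β γ) m T) (φ : forms q 1)
    (i : Idx) : (T 1 2 rfl φ).1 ((frameTwo q).word i) =
      (hodgeOne q m α β γ i * scaleTwo q i) • φ.1 ((frameOne q).word i) := by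
  have hm' : (m : ℂ) ≠ 0 := Complex.ofReal_ne_zero.mpr hm
  have hq := qC_ne_zero q
  rw [(isDualAt_one q α β γ hm _).mp (hT 1 2 rfl), show lam q 1 = 1 from rfl, Complex.ofReal_one]
  congr 1
  cases i <;> simp only [gramOne, pairCoeff, hodgeOne, scaleTwo] <;> field_simp

theorem dual_two_word (hm : m ≠ 0) (hT : IsDual q (contraction α β γ) m T) (φ : forms q 2)
    (i : Idx) : (T 2 1 rfl φ).1 ((frameOne q).word i) =
      (hodgeTwo q m α β γ i / scaleTwo q i) • φ.1 ((frameTwo q).word i) := by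
  have hm' : (m : ℂ) ≠ 0 := Complex.ofReal_ne_zero.mpr hm
  have hq := qC_ne_zero q
  have hl := lam_ne_zero q 2
  rw [(isDualAt_two q α β γ hm _).mp (hT 2 1 rfl)]
  congr 1
  cases i <;> simp only [gramTwo, pairCoeff, hodgeTwo, scaleTwo] <;> field_simp

theorem dual_omega (hm : m ≠ 0) (hT : IsDual q (contraction α β γ) m T) (a : Idx) :
    T 1 2 rfl (omega q a) = hodgeOne q m α β γ a • basisTwo q a := by
  refine (frameTwo q).ext_forms fun i => ?_
  rw [dual_one_word hm hT, coe_smul_apply, omega_word, basisTwo_word]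
  split_ifs with h
  · rw [h, Algebra.algebraMap_eq_smul_one, smul_smul]
  · rw [smul_zero, smul_zero]

theorem dual_basisTwo (hm : m ≠ 0) (hT : IsDual q (contraction α β γ) m T) (a : Idx) :
    T 2 1 rfl (basisTwo q a) = hodgeTwo q m α β γ a • omega q a := by
  refine (frameOne q).ext_forms fun i => ?_
  rw [dual_two_word hm hT, coe_smul_apply, omega_word, basisTwo_word]
  split_ifs with h
  · rw [h, Algebra.algebraMap_eq_smul_one, smul_smul, div_mul_cancel₀ _ (scaleTwo_ne_zero q i)]
  · rw [smul_zero, smul_zero]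

theorem isSymm_iff (hm : m ≠ 0) (hT : IsDual q (contraction α β γ) m T) :
    IsSymm q T ↔ ∃ ζ, ∀ a, hodgeOne q m α β γ a * hodgeTwo q m α β γ a = ζ := by
  constructor
  · rintro ⟨ζ, h⟩
    refine ⟨ζ, fun a => smul_right_cancel_of_one (q := q) ?_⟩
    have e := congrArg (fun φ : forms q 1 => φ.1 ((frameOne q).word a)) (h (omega q a))
    simpa only [dual_omega hm hT, map_smul, dual_basisTwo hm hT, smul_smul, coe_smul_apply,
      omega_word, if_true] using e
  · rintro ⟨ζ, h⟩
    refine ⟨ζ, fun φ => (frameOne q).ext_forms fun a => ?_⟩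
    rw [dual_two_word hm hT, dual_one_word hm hT, smul_smul, coe_smul_apply, ← h a]
    congr 1
    have := scaleTwo_ne_zero q a
    field_simp

/-- The entries of the Hodge operator satisfy the symmetry condition precisely for
`β = q ^ 6 α`. -/
theorem hodge_entries_iff (hm : m ≠ 0) (h0 : α * β * γ ≠ 0) :
    (∃ ζ, ∀ a, hodgeOne q m α β γ a * hodgeTwo q m α β γ a = ζ) ↔ β = qC q ^ 6 * α := by
  have hm' : (m : ℂ) ≠ 0 := Complex.ofReal_ne_zero.mpr hm
  have hq := qC_ne_zero q
  have hl := lam_ne_zero q 2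
  have hα : α ≠ 0 := fun e => h0 (by simp [e])
  have hγ : γ ≠ 0 := fun e => h0 (by simp [e])
  constructor
  · rintro ⟨ζ, h⟩
    have e := (h .zed).trans (h .plus).symm
    simp only [hodgeOne, hodgeTwo] at e
    field_simp at e
    linear_combination -e
  · rintro rfl
    refine ⟨-2 * (lam q 2 : ℂ)⁻¹ * m ^ 2 * α * (qC q ^ 6 * α) * γ, fun a => ?_⟩
    cases a <;> simp only [hodgeOne, hodgeTwo] <;> field_simp

theorem starForm_omega (a : Idx) : starForm q (omega q a) = -omega q a.bar := by
  refine (frameOne q).ext_forms fun i => ?_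
  have e : (fun j : Fin 1 => (![i] j.rev).bar) = ![i.bar] := by funext j; fin_cases j; rfl
  change (-1 : SUq q) ^ (1 * (1 - 1) / 2 + 1) * twist q _ (star ((omega q a).1 _)) =
    -((omega q a.bar).1 ((frameOne q).word i))
  have h := omega_word q a i.bar
  rw [omega_word]
  simp only [frameOne] at h ⊢
  rw [e, h]
  cases a <;> cases i <;> simp [Idx.bar]

theorem starForm_smul {k : ℕ} (t : ℂ) (φ : forms q k) :
    starForm q (t • φ) = starRingEnd ℂ t • starForm q φ := by
  refine Subtype.ext (funext fun w => ?_)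
  change (-1 : SUq q) ^ _ * twist q _ (star (t • φ.1 _)) =
    starRingEnd ℂ t • ((-1 : SUq q) ^ _ * twist q _ (star (φ.1 _)))
  rw [star_smul, map_smul, mul_smul_comm]
  rfl

/-- The involution of 2-forms exchanges `ω_- ∧ ω_z` and `ω_+ ∧ ω_z` up to these factors. -/
def starCoeff (q : Set.Ioo (0 : ℝ) 1) : Idx → ℂ
  | .minus => (qC q ^ 4)⁻¹
  | .plus => qC q ^ 4
  | .zed => -1

theorem starForm_basisTwo (a : Idx) :
    starForm q (basisTwo q a) = starCoeff q a • basisTwo q a.bar := by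
  have hq := qC_ne_zero q
  have key : ∀ b c : Idx, (starForm q (basisTwo q a)).1 ![b, c] =
      -twist q (weight ![b, c]) (star ((basisTwo q a).1 ![c.bar, b.bar])) := fun b c => by
    have e : (fun j : Fin 2 => (![b, c] j.rev).bar) = ![c.bar, b.bar] := by
      funext j; fin_cases j <;> rfl
    change (-1 : SUq q) ^ (2 * (2 - 1) / 2 + 2) * twist q _ (star ((basisTwo q a).1 _)) = _
    rw [e]
    norm_num
  obtain ⟨-, -, r2, r3⟩ := exchange_two q (basisTwo q a).2
  have v1 := basisTwo_word q a .minus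
  have v2 := basisTwo_word q a .plus
  have v3 := basisTwo_word q a .zed
  refine (frameTwo q).ext_forms fun i => ?_
  rw [coe_smul_apply, basisTwo_word]
  simp only [frameTwo, wordTwo] at v1 v2 v3 ⊢
  cases i <;> simp only [key, Idx.bar, r2, r3, v1, v2, v3] <;> cases a <;>
    simp [starCoeff, scaleTwo, conj_qC, Algebra.algebraMap_eq_smul_one, smul_smul,
      -smul_eq_mul] <;>
    congr 1 <;> field_simp

theorem isReal_iff (hm : m ≠ 0) (hT : IsDual q (contraction α β γ) m T) :
    IsReal q T ↔ β = qC q ^ 6 * starRingEnd ℂ α ∧ starRingEnd ℂ γ = γ := by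
  have hm' : (m : ℂ) ≠ 0 := Complex.ofReal_ne_zero.mpr hm
  have hq := qC_ne_zero q
  have hn : ∀ (t : ℂ) (φ : forms q 2), -(t • φ) = (-t) • φ := fun t φ =>
    Subtype.ext (neg_smul t φ.1).symm
  have key : IsReal q T ↔
      ∀ a, -hodgeOne q m α β γ a.bar = starRingEnd ℂ (hodgeOne q m α β γ a) * starCoeff q a := by
    refine forall_congr' fun a => ?_
    rw [starForm_omega, map_neg, dual_omega hm hT, dual_omega hm hT, starForm_smul,
      starForm_basisTwo, smul_smul, hn]
    refine ⟨fun h => mul_right_cancel₀ (scaleTwo_ne_zero q a.bar)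
      (smul_right_cancel_of_one (q := q) ?_), fun h => by rw [h]⟩
    have e := congrArg (fun φ : forms q 2 => φ.1 ((frameTwo q).word a.bar)) h
    simpa only [coe_smul_apply, basisTwo_word, if_true, Algebra.algebraMap_eq_smul_one,
      smul_smul] using e
  rw [key]
  constructor
  · intro h
    have h1 := h .plus
    have h2 := h .zed
    simp only [Idx.bar, hodgeOne, starCoeff, map_mul, Complex.conj_ofReal] at h1 h2
    constructor
    · field_simp at h1
      linear_combination h1
    · refine mul_left_cancel₀ hm' ?_
      linear_combination h2
  · rintro ⟨rfl, h⟩ a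
    cases a <;>
      simp only [Idx.bar, hodgeOne, starCoeff, map_mul, map_neg, map_inv₀, map_pow, conj_qC,
        Complex.conj_ofReal, Complex.conj_conj, h] <;>
      field_simp

theorem qdet_contraction (q : Set.Ioo (0 : ℝ) 1) (α β γ : ℂ) (m : ℝ) :
    qdet q (contraction α β γ) m =
      -6 * qC q ^ 4 * (lam q 3 : ℂ)⁻¹ * m ^ 2 * (α * β * γ) := by
  have hq := qC_ne_zero q
  have ht : (thetaInv q).1 topWord = qC q ^ 4 := by
    change asym q ℂ 3 (Pi.single topWord 1) topWord = _
    rw [asym_three_topWord]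
    simp [topWord, funext_iff, Fin.forall_fin_succ]
  have hv : ((m : ℂ) • thetaInv q).1 topWord = m * qC q ^ 4 := by rw [← ht]; rfl
  rw [qdet, scal, contract_three, Fintype.sum_unique]
  simp only [frameThree, hv, star_one, mul_one, haar_one, map_mul, map_pow, conj_qC,
    Complex.conj_ofReal]
  push_cast
  field_simp

theorem qdet_contraction_ofReal (q : Set.Ioo (0 : ℝ) 1) (α β γ m : ℝ) :
    qdet q (contraction α β γ) m =
      ((-(6 * (q : ℝ) ^ 4 * (lam q 3)⁻¹ * m ^ 2 * (α * β * γ)) : ℝ) : ℂ) := by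
  rw [qdet_contraction, qC]
  push_cast
  ring

/-- The signature is opposite to the sign of `γ`, since `αβ = q ^ 6 α² > 0`. -/
theorem sgn_contraction (q : Set.Ioo (0 : ℝ) 1) {m α β γ : ℝ} (hm : m ≠ 0)
    (hβ : β = (q : ℝ) ^ 6 * α) (h0 : α * γ ≠ 0) :
    sgn q (contraction α β γ) m = -Real.sign γ := by
  have hq := q.2.1
  have hl := lam_pos q 3
  have hα : α ≠ 0 := left_ne_zero_of_mul h0
  have hK : 0 < 6 * (q : ℝ) ^ 4 * (lam q 3)⁻¹ * m ^ 2 * (q : ℝ) ^ 6 * α ^ 2 := by positivity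
  rw [sgn, qdet_contraction_ofReal, Complex.ofReal_re, Real.sign_neg, hβ]
  congr 1
  rw [show 6 * (q : ℝ) ^ 4 * (lam q 3)⁻¹ * m ^ 2 * (α * ((q : ℝ) ^ 6 * α) * γ) =
    6 * (q : ℝ) ^ 4 * (lam q 3)⁻¹ * m ^ 2 * (q : ℝ) ^ 6 * α ^ 2 * γ by ring]
  rcases (right_ne_zero_of_mul h0).lt_or_gt with h | h
  · rw [Real.sign_of_neg h, Real.sign_of_neg (mul_neg_of_pos_of_neg hK h)]
  · rw [Real.sign_of_pos h, Real.sign_of_pos (mul_pos hK h)]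

/-- The value of `T²(1)`, as a criterion for it to be a given real number `s`. -/
theorem dual_dual_oneForm_iff {α β γ : ℝ} (hm : m ≠ 0) (hT : IsDual q (contraction α β γ) m T)
    (s : ℝ) : T 3 0 rfl (T 0 3 rfl (oneForm q)) = (s : ℂ) • oneForm q ↔
      s = -(6 * (q : ℝ) ^ 4 * (lam q 3)⁻¹ * m ^ 2 * (α * β * γ)) := by
  have e : (m : ℂ) * (-6 * qC q ^ 4 * (lam q 3 : ℂ)⁻¹ * m * α * β * γ) =
      ((-(6 * (q : ℝ) ^ 4 * (lam q 3)⁻¹ * m ^ 2 * (α * β * γ)) : ℝ) : ℂ) := by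
    rw [qC]
    push_cast
    ring
  rw [dual_oneForm hm hT, vol, map_smul, dual_theta hm hT, smul_smul, e]
  constructor
  · intro h
    have h1 := congrArg (fun φ : forms q 0 => φ.1 ((frameZero q).word ())) h
    simp only [coe_smul_apply, oneForm_word] at h1
    exact (Complex.ofReal_injective (smul_right_cancel_of_one (q := q) h1)).symm
  · rintro rfl
    rfl

/-- The normalisation `T²(1) = sgn(g)` reads `m² = λ₃ / (6 q⁴ αβ |γ|)`. -/
theorem exists_abs_eq_iff (q : Set.Ioo (0 : ℝ) 1) {α β γ : ℝ} (hβ : β = (q : ℝ) ^ 6 * α)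
    (h0 : α * γ ≠ 0) : ∃ r : ℝ, 0 < r ∧ ∀ m : ℝ,
      -Real.sign γ = -(6 * (q : ℝ) ^ 4 * (lam q 3)⁻¹ * m ^ 2 * (α * β * γ)) ↔ |m| = r := by
  have hq := q.2.1
  have hl := lam_pos q 3
  have hα : α ≠ 0 := left_ne_zero_of_mul h0
  have hγ : γ ≠ 0 := right_ne_zero_of_mul h0
  set K : ℝ := 6 * (q : ℝ) ^ 4 * (lam q 3)⁻¹ * (q : ℝ) ^ 6 * α ^ 2 * |γ| with hK
  have hK0 : 0 < K := by positivity
  refine ⟨√(1 / K), Real.sqrt_pos.mpr (by positivity), fun m => ?_⟩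
  have h1 : |m| = √(1 / K) ↔ 1 = m ^ 2 * K := by
    rw [eq_comm, Real.sqrt_eq_iff_mul_self_eq (by positivity) (abs_nonneg m), abs_mul_abs_self,
      div_eq_iff hK0.ne', ← pow_two]
  rw [h1, neg_inj, hK, hβ]
  rcases hγ.lt_or_gt with h | h
  · rw [Real.sign_of_neg h, abs_of_neg h]
    constructor <;> intro e <;> linear_combination -e
  · rw [Real.sign_of_pos h, abs_of_pos h]
    constructor <;> intro e <;> linear_combination e

end

end QHodge

end

theorem mainTheorem1 (q : Set.Ioo (0 : ℝ) 1) :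
    (∀ g : Contraction, (RightInvariant g ∧ g.Nondegenerate) ↔
      ∃ α β γ : ℂ, g = contraction α β γ ∧ α * β * γ ≠ 0) ∧
    (∀ (m : ℝ) (g : Contraction), m ≠ 0 → RightInvariant g → g.Nondegenerate →
      (∃! T, IsDual q g m T) ∧ ∀ T, IsDual q g m T → IsLeftLinear q T) ∧
    (∀ (m : ℝ) (g : Contraction), m ≠ 0 → (g ∈ symmRealContractions q m ↔
      ∃ α β γ : ℂ, g = contraction α β γ ∧ β = (q : ℂ) ^ 6 * α ∧ β.im = 0 ∧ γ.im = 0 ∧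
        α * γ ≠ 0)) ∧
    (∀ (m α β γ : ℝ) (T : FormOperator q), m ≠ 0 → β = (q : ℝ) ^ 6 * α → α * γ ≠ 0 →
      IsDual q (contraction α β γ) m T →
      let lam2 := lam q 2
      let lam3 := lam q 3
      let g := contraction α β γ
      let om := omega q .minus
      let op := omega q .plus
      let oz := omega q .zed
      T 0 3 rfl (oneForm q) = vol q m ∧
      T 1 2 rfl om = ((-((q : ℝ) ^ 2)⁻¹ * m * β : ℝ) : ℂ) • wedge q om oz ∧
      T 1 2 rfl op = ((m * α : ℝ) : ℂ) • wedge q op oz ∧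
      T 1 2 rfl oz = ((m * γ : ℝ) : ℂ) • wedge q om op ∧
      T 2 1 rfl (wedge q om oz) = ((2 * ((q : ℝ) ^ 4)⁻¹ * lam2⁻¹ * m * β * γ : ℝ) : ℂ) • om ∧
      T 2 1 rfl (wedge q op oz) = ((-2 * (q : ℝ) ^ 6 * lam2⁻¹ * m * α * γ : ℝ) : ℂ) • op ∧
      T 2 1 rfl (wedge q om op) = ((-2 * lam2⁻¹ * m * α * β : ℝ) : ℂ) • oz ∧
      T 3 0 rfl (theta q) = ((-6 * (q : ℝ) ^ 4 * lam3⁻¹ * m * α * β * γ : ℝ) : ℂ) • oneForm q ∧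
      (qdet q g m).im = 0 ∧
      sgn q g m = -Real.sign γ ∧
      (T 3 0 rfl (T 0 3 rfl (oneForm q)) = (sgn q g m : ℂ) • oneForm q →
        ∀ a, T 2 1 rfl (T 1 2 rfl (omega q a)) =
          ((sgn q g m * (2 * lam3) * (6 * (q : ℝ) ^ 4 * lam2)⁻¹ : ℝ) : ℂ) • omega q a)) ∧
    (∀ α β γ : ℝ, β = (q : ℝ) ^ 6 * α → α * γ ≠ 0 →
      ∃ r : ℝ, 0 < r ∧ ∀ (m : ℝ) (T : FormOperator q), m ≠ 0 →
        IsDual q (contraction α β γ) m T →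
        (T 3 0 rfl (T 0 3 rfl (oneForm q)) = (sgn q (contraction α β γ) m : ℂ) • oneForm q ↔
          |m| = r)) := by
  refine ⟨fun g => ?_, fun m g hm hR hN => ?_, fun m g hm => ?_,
    fun m α β γ T hm hβ h0 hT => ?_, fun α β γ hβ h0 => ?_⟩
  · rw [rightInvariant_iff]
    constructor
    · rintro ⟨⟨α, β, γ, rfl⟩, hN⟩
      exact ⟨α, β, γ, rfl, (contraction_nondegenerate_iff α β γ).mp hN⟩
    · rintro ⟨α, β, γ, rfl, h⟩
      exact ⟨⟨α, β, γ, rfl⟩, (contraction_nondegenerate_iff α β γ).mpr h⟩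
  · obtain ⟨α, β, γ, rfl⟩ := (rightInvariant_iff g).mp hR
    exact existsUnique_isDual q α β γ hm
  · have hq := qC_ne_zero q
    constructor
    · rintro ⟨hR, hN, T, hT, hS, hr⟩
      obtain ⟨α, β, γ, rfl⟩ := (rightInvariant_iff g).mp hR
      have h0 := (contraction_nondegenerate_iff α β γ).mp hN
      have h1 := (hodge_entries_iff hm h0).mp ((isSymm_iff hm hT).mp hS)
      obtain ⟨h2, h3⟩ := (isReal_iff hm hT).mp hr
      have h4 : starRingEnd ℂ β = β := by
        rw [h2, map_mul, map_pow, conj_qC, Complex.conj_conj, ← h1, h2]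
      exact ⟨α, β, γ, rfl, h1, Complex.conj_eq_iff_im.mp h4, Complex.conj_eq_iff_im.mp h3,
        fun e => h0 (by rw [mul_right_comm, e, zero_mul])⟩
    · rintro ⟨α, β, γ, rfl, h1, h2, h3, h0⟩
      have hα : α ≠ 0 := left_ne_zero_of_mul h0
      have hβ : β ≠ 0 := by rw [h1]; exact mul_ne_zero (pow_ne_zero 6 hq) hα
      have h0' : α * β * γ ≠ 0 := by rw [mul_right_comm]; exact mul_ne_zero h0 hβ
      obtain ⟨T, hT, -⟩ := (existsUnique_isDual q α β γ hm).1
      refine ⟨(rightInvariant_iff _).mpr ⟨α, β, γ, rfl⟩,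
        (contraction_nondegenerate_iff α β γ).mpr h0', T, hT,
        (isSymm_iff hm hT).mpr ((hodge_entries_iff hm h0').mpr h1),
        (isReal_iff hm hT).mpr ⟨?_, Complex.conj_eq_iff_im.mpr h3⟩⟩
      have h4 := Complex.conj_eq_iff_im.mpr h2
      change β = qC q ^ 6 * α at h1
      rw [← h4, h1, map_mul, map_pow, conj_qC]
  · have h1 := fun a => dual_omega hm hT a
    have h2 := fun a => dual_basisTwo hm hT a
    have hs := sgn_contraction q hm hβ h0
    refine ⟨dual_oneForm hm hT, (h1 .minus).trans ?_, (h1 .plus).trans ?_, (h1 .zed).trans ?_,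
      (h2 .minus).trans ?_, (h2 .plus).trans ?_, (h2 .zed).trans ?_, (dual_theta hm hT).trans ?_,
      ?_, hs, fun hn a => ?_⟩
    -- The seven values of `T`, whose real coefficients are the complex ones of `hodgeOne`,
    -- `hodgeTwo` and `dual_theta`.
    iterate 7
      · refine congrArg (· • _) ?_
        simp only [hodgeOne, hodgeTwo, qC]
        push_cast
        rfl
    · rw [qdet_contraction_ofReal]
      exact Complex.ofReal_im _
    · rw [dual_dual_oneForm_iff hm hT] at hn
      rw [h1, map_smul, h2, smul_smul]
      refine congrArg (· • _) ?_
      rw [hn]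
      have hβ' : (β : ℂ) = (q : ℝ) ^ 6 * α := by rw [hβ]; push_cast; rfl
      have hqC := qC_ne_zero q
      have hl2 := lam_ne_zero q 2
      have hl3 := lam_ne_zero q 3
      push_cast
      rw [hβ']
      cases a <;> simp only [hodgeOne, hodgeTwo, qC] at hqC ⊢ <;> field_simp
  · obtain ⟨r, hr, h⟩ := exists_abs_eq_iff q hβ h0
    refine ⟨r, hr, fun m T hm hT => ?_⟩
    rw [dual_dual_oneForm_iff hm hT, sgn_contraction q hm hβ h0, h]
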